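/- Let $B$ be a complex Banach space and $B_0,B_1$ reflexive complex Banach spaces with $B_0\subset B\subset B_1$, where $B_0$ is dense in $B$, $B$ is dense in $B_1$, and the inclusions $\mathcal I_0:B_0\hookrightarrow B$ and $\mathcal I:B\hookrightarrow B_1$ are continuous. Let $Q:\mathrm{Dom}(Q)\subset B\to B$ be a closed linear operator, let $S:B\to B_0$ be linear and extend to a bounded operator $B_1\to B_0$ (again denoted $S$), and put $P:=Q+S$ with $\mathrm{Dom}(P)=\mathrm{Dom}(Q)$. Let $D\subset\mathbb C$ be a non-empty open set contained in the resolvent sets of both $P$ and $Q$, and let $D^+\supset D$ be an open set each of whose connected components meets $D$ (for instance a connected open set). Assume that $D\ni z\mapsto \mathcal I(P-z)^{-1}\mathcal I_0\in\mathcal B(B_0,B_1)$ has a finite meromorphic extension $R(z)$ to $D^+$ (meromorphic, with finite rank coefficients in the principal part at each pole), and that $D\ni z\mapsto \mathcal I(Q-z)^{-1}\mathcal I_0\in\mathcal B(B_0,B_1)$ has an analytic extension $R_0(z)$ to $D^+$. Assume moreover: (I) the operator $\mathcal P$ in $B_1$ with $\mathrm{Dom}(\mathcal P)=\mathcal I\,\mathrm{Dom}(P)$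 and $\mathcal P\,\mathcal I u=\mathcal I Pu$ is closable in $B_1$; (II) the set $\{u\in B_0\cap \mathrm{Dom}(P): Pu\in B_0\}$ is dense in $B_0$. Let $z_0\in D^+$ be a pole of $R(z)$, and write $R(z)=\sum_{j=1}^{L}A_{-j}(z-z_0)^{-j}+\mathrm{Hol}(z)$ near $z_0$. Let $\gamma$ be a closed piecewise $C^1$ curve in $D^+$ passing through no pole of $R$, with winding number $1$ about $z_0$ and winding number $0$ about every other pole of $R$ in $D^+$ and about every point of $\mathbb C\setminus D^+$ (for instance, a positively oriented piecewise $C^1$ Jordan curve which together with its interior lies in $D^+$, which passes through no pole, and whose interior contains $z_0$ and no other pole of $R$). Then $A_{-1}$ has finite rank, $A_{-1}=\frac1{2\pi i}\oint_\gamma R(z)\,dz$, the operator $I+SR_0(z)$ on $B_0$ is invertible for every $z$ on $\gamma$, the operator $\oint_\gamma \partial_z\big(I+SR_0(z)\big)\,\big(I+SR_0(z)\big)^{-1}dz$ on $B_0$ has finite rank, and $$\operatorname{rank}(A_{-1})=\operatorname{Ind}_\gamma\big(I+SR_0(z)\big):=\frac1{2\pi i}\operatorname{Tr}\oint_\gamma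 \partial_z\big(I+SR_0(z)\big)\,\big(I+SR_0(z)\big)^{-1}dz .$$ Hence the two definitions of the multiplicity of the pole $z_0$, namely $\operatorname{rank}\frac1{2\pi i}\oint_\gamma R(z)\,dz$ and $\operatorname{Ind}_\gamma(I+SR_0(z))$, agree. -/

import Mathlib

open Set Filter Topology

noncomputable section

namespace AbstractResonance

section Operators

variable {X Y : Type*} [NormedAddCommGroup X] [NormedSpace ℂ X]
  [NormedAddCommGroup Y] [NormedSpace ℂ Y]

/-- A normed space is reflexive if the canonical embedding into its bidual is onto. -/
def IsReflexive (X : Type*) [NormedAddCommGroup X] [NormedSpace ℂ X] : Prop :=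
  Function.Surjective (NormedSpace.inclusionInDoubleDual ℂ X)

/-- `T` is the bounded everywhere defined inverse `(A - z)⁻¹` of `A - z : Dom A → X`. -/
def IsResolventAt (A : X →ₗ.[ℂ] X) (z : ℂ) (T : X →L[ℂ] X) : Prop :=
  (∀ x : X, ∃ h : T x ∈ A.domain, A ⟨T x, h⟩ - z • T x = x) ∧
    ∀ u : A.domain, T (A u - z • (u : X)) = u

/-- The resolvent set of an unbounded operator. -/
def resolventSet (A : X →ₗ.[ℂ] X) : Set ℂ := {z | ∃ T : X →L[ℂ] X, IsResolventAt A z T}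

/-- The operator with domain `j (Dom A)` that sends `j u` to `j (A u)`. -/
def pushforward (j : X →L[ℂ] Y) (hj : Function.Injective j) (A : X →ₗ.[ℂ] X) :
    Y →ₗ.[ℂ] Y where
  domain := A.domain.map j.toLinearMap
  toFun := j.toLinearMap ∘ₗ A.toFun ∘ₗ
    (Submodule.equivMapOfInjective j.toLinearMap hj A.domain).symm.toLinearMap

/-- A bounded operator has finite rank if its range is finite-dimensional. -/
def HasFiniteRank (T : X →L[ℂ] Y) : Prop :=
  Module.Finite ℂ (LinearMap.range T.toLinearMap)

/-- The rank of a finite rank operator. -/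
def rank (T : X →L[ℂ] Y) : ℕ := Module.finrank ℂ (LinearMap.range T.toLinearMap)

/-- The trace of a finite rank operator: the trace of the endomorphism that it induces on its
(finite-dimensional) range. -/
def finiteRankTrace (T : X →L[ℂ] X) : ℂ :=
  LinearMap.trace ℂ (LinearMap.range T.toLinearMap)
    (T.toLinearMap.restrict (p := LinearMap.range T.toLinearMap)
      (q := LinearMap.range T.toLinearMap) fun x _ => LinearMap.mem_range_self T.toLinearMap x)

end Operators

section Meromorphic

variable {E : Type*} [NormedAddCommGroup E] [NormedSpace ℂ E]

/-- Near `w` (and off `w`), `F z = ∑_{1 ≤ j ≤ L} (z - w)⁻ʲ A j + (holomorphic at w)`; thus `A j` is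
the Laurent coefficient of `F` at `w` with index `-j`, and it is `0` for `j > L`. -/
def HasPrincipalPart (F : ℂ → E) (w : ℂ) (L : ℕ) (A : ℕ → E) : Prop :=
  (∀ j, L < j → A j = 0) ∧
    ∃ H : ℂ → E, AnalyticAt ℂ H w ∧
      ∀ᶠ z in 𝓝[≠] w, F z = (∑ j ∈ Finset.Icc 1 L, ((z - w) ^ j)⁻¹ • A j) + H z

/-- `w` is a pole of `F`: `F` is meromorphic at `w` with negative order there. -/
def IsPole (F : ℂ → E) (w : ℂ) : Prop := MeromorphicAt F w ∧ meromorphicOrderAt F w < 0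

end Meromorphic

section FiniteMeromorphic

variable {X Y : Type*} [NormedAddCommGroup X] [NormedSpace ℂ X]
  [NormedAddCommGroup Y] [NormedSpace ℂ Y]

/-- `F` is finite meromorphic on `U`: it is holomorphic off its poles, and at each point of `U` it
has a Laurent expansion with finite principal part, whose coefficients have finite rank. -/
def FiniteMeromorphicOn (F : ℂ → X →L[ℂ] Y) (U : Set ℂ) : Prop :=
  ∀ w ∈ U, (∃ (L : ℕ) (A : ℕ → X →L[ℂ] Y), HasPrincipalPart F w L A ∧ ∀ j, HasFiniteRank (A j)) ∧
    (¬ IsPole F w → AnalyticAt ℂ F w)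

end FiniteMeromorphic

section Contours

variable {E : Type*} [NormedAddCommGroup E] [NormedSpace ℂ E]

/-- `γ`, restricted to `[0, 1]`, is a closed piecewise continuously differentiable curve: it is
continuous and, off finitely many parameters, has a continuous bounded derivative. -/
def IsPiecewiseC1Loop (γ : ℝ → ℂ) : Prop :=
  γ 0 = γ 1 ∧ ContinuousOn γ (Icc 0 1) ∧
    ∃ s : Finset ℝ, (∀ t ∈ Ioo (0 : ℝ) 1 \ s, DifferentiableAt ℝ γ t) ∧
      ContinuousOn (deriv γ) (Ioo (0 : ℝ) 1 \ s) ∧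
      ∃ C : ℝ, ∀ t ∈ Ioo (0 : ℝ) 1 \ s, ‖deriv γ t‖ ≤ C

/-- Integrability of `F(z) dz` along `γ`. -/
def ContourIntegrable (γ : ℝ → ℂ) (F : ℂ → E) : Prop :=
  IntervalIntegrable (fun t => deriv γ t • F (γ t)) MeasureTheory.volume 0 1

/-- The contour integral `∮_γ F(z) dz`. -/
def contourIntegral (γ : ℝ → ℂ) (F : ℂ → E) : E := ∫ t in (0 : ℝ)..1, deriv γ t • F (γ t)

/-- The winding number `(2πi)⁻¹ ∮_γ (z - w)⁻¹ dz` of `γ` about `w`. -/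
def windingNumber (γ : ℝ → ℂ) (w : ℂ) : ℂ :=
  (2 * Real.pi * Complex.I)⁻¹ * contourIntegral γ fun z => (z - w)⁻¹

/-- `γ` is a closed curve in `U`, avoiding the exceptional set `Z`, that winds once in the positive
sense about `z₀` and does not wind about any other point of `Z` nor about any point outside `U`.
A positively oriented piecewise smooth Jordan curve in `U` whose interior lies in `U` is of this
kind as soon as `z₀` is the only point of `Z` that is on it or inside it, and is inside it. -/
def IsPositiveContourAround (γ : ℝ → ℂ) (z₀ : ℂ) (U Z : Set ℂ) : Prop :=
  IsPiecewiseC1Loop γ ∧ (∀ t ∈ Icc (0 : ℝ) 1, γ t ∈ U ∧ γ t ∉ Z ∧ γ t ≠ z₀) ∧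
    windingNumber γ z₀ = 1 ∧
    (∀ w ∈ Z, w ≠ z₀ → windingNumber γ w = 0) ∧ ∀ w, w ∉ U → windingNumber γ w = 0

variable {X : Type*} [NormedAddCommGroup X] [NormedSpace ℂ X]

/-- The integrand `F'(z) F(z)⁻¹` of the index. -/
def logDerivative (F : ℂ → X →L[ℂ] X) (z : ℂ) : X →L[ℂ] X := deriv F z * Ring.inverse (F z)

/-- The integral `(2πi)⁻¹ ∮_γ F'(z) F(z)⁻¹ dz`. -/
def indexOperator (γ : ℝ → ℂ) (F : ℂ → X →L[ℂ] X) : X →L[ℂ] X :=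
  (2 * Real.pi * Complex.I)⁻¹ • contourIntegral γ (logDerivative F)

/-- The index of `F` along `γ` is defined: `F` is differentiable and invertible at the points of
`γ`, `F' F⁻¹` is integrable along `γ`, and the integral is a finite rank operator. -/
def HasIndex (γ : ℝ → ℂ) (F : ℂ → X →L[ℂ] X) : Prop :=
  (∀ t ∈ Icc (0 : ℝ) 1, DifferentiableAt ℂ F (γ t) ∧ IsUnit (F (γ t))) ∧
    ContourIntegrable γ (logDerivative F) ∧ HasFiniteRank (indexOperator γ F)

/-- The index `Ind_γ F = (2πi)⁻¹ Tr ∮_γ F'(z) F(z)⁻¹ dz`. -/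
def index (γ : ℝ → ℂ) (F : ℂ → X →L[ℂ] X) : ℂ := finiteRankTrace (indexOperator γ F)

end Contours

end AbstractResonance

end

/-!
Write `J` for the inclusion of `B₀` in `B₁`. On `D` the resolvent identities read
`R (1 + S R₀) = R₀ = (1 + R₀ S) R`; they continue to all of `Dplus`, because each of its components
meets `D`. Hence `1 + S R₀` has the inverse `1 - S R` off the poles of `R`, and its logarithmic
derivative is `S R₀' (1 - S R)`.

The relation `(P - z) R z = J` continues as well, in the quotient of `B₁ × B₁` by the closed graph
of the closure of `P` (Condition I), and so does `R z (P - z) u = J u` for the `u` of Condition II.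
Comparing Laurent coefficients at `z₀` shows that `P - z₀` acts on `W = range (A 1)` as a nilpotent
operator `N` with `A (j + 1) = N ∘ A j` (`exists_nilpotent_of_chain`). So the principal part of `R`
is `(z - z₀ - N)⁻¹ ∘ A 1`.

Only the principal part of `R` contributes to the contour integral of `S R₀' (1 - S R)`. The
contribution factors through `W`, so it has finite rank, and its trace is the contour
integral of the trace of an operator on the finite-dimensional space `W`. The resolvent identities
show that this integrand is the trace of `(z - z₀ - N)⁻¹` up to a function analytic at `z₀`
(`exists_analyticAt_trace_eq`). As `N` is nilpotent, this trace is `dim W / (z - z₀)`, and the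
residue is `dim W = rank (A 1)` (`index_eq_finrank`).

The contours are general loops with prescribed winding numbers, so Cauchy's theorem is needed in its
homology form (`IsPiecewiseC1Loop.contourIntegral_eq_zero`).
-/

noncomputable section

namespace AbstractResonance

/-! ### Contour integrals and Cauchy's theorem -/

section Cauchy

open MeasureTheory Metric

variable {E : Type*} [NormedAddCommGroup E] [NormedSpace ℂ E]

/-- The speed of a loop is essentially bounded, so every continuous integrand is integrable. -/
theorem IsPiecewiseC1Loop.exists_ae_bound {γ : ℝ → ℂ} (hγ : IsPiecewiseC1Loop γ) :
    ∃ C : ℝ, 0 ≤ C ∧ ∀ᵐ t ∂(volume.restrict (Ioc (0 : ℝ) 1)), ‖deriv γ t‖ ≤ C := by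
  obtain ⟨-, -, s, -, -, C, hC⟩ := hγ
  refine ⟨max C 0, le_max_right _ _, ?_⟩
  have h1 : ∀ᵐ t ∂(volume.restrict (Ioc (0 : ℝ) 1)), t ∉ (insert 1 s : Finset ℝ) :=
    ae_restrict_of_ae <|
      (measure_eq_zero_iff_ae_notMem).1 ((insert 1 s : Finset ℝ).finite_toSet.measure_zero volume)
  filter_upwards [h1, ae_restrict_mem measurableSet_Ioc] with t ht ht'
  simp only [Finset.mem_insert, not_or] at ht
  exact (hC t ⟨⟨ht'.1, lt_of_le_of_ne ht'.2 ht.1⟩, ht.2⟩).trans (le_max_left _ _)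

theorem IsPiecewiseC1Loop.integrable_smul {γ : ℝ → ℂ} (hγ : IsPiecewiseC1Loop γ) {φ : ℝ → E}
    (hφ : ContinuousOn φ (Icc 0 1)) :
    Integrable (fun t => deriv γ t • φ t) (volume.restrict (Ioc (0 : ℝ) 1)) := by
  obtain ⟨C, -, hC⟩ := hγ.exists_ae_bound
  have hi : Integrable φ (volume.restrict (Ioc (0 : ℝ) 1)) :=
    (hφ.integrableOn_Icc (μ := volume)).mono_set Ioc_subset_Icc_self
  exact hi.bdd_smul C (stronglyMeasurable_deriv γ).aestronglyMeasurable hC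

theorem IsPiecewiseC1Loop.contourIntegrable {γ : ℝ → ℂ} (hγ : IsPiecewiseC1Loop γ) {f : ℂ → E}
    {U : Set ℂ} (hf : ContinuousOn f U) (hU : ∀ t ∈ Icc (0 : ℝ) 1, γ t ∈ U) :
    ContourIntegrable γ f := by
  rw [ContourIntegrable, intervalIntegrable_iff_integrableOn_Ioc_of_le zero_le_one]
  exact hγ.integrable_smul (hf.comp hγ.2.1 hU)

theorem contourIntegral_sub {γ : ℝ → ℂ} {f g : ℂ → E} (hf : ContourIntegrable γ f)
    (hg : ContourIntegrable γ g) :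
    contourIntegral γ (fun z => f z - g z) = contourIntegral γ f - contourIntegral γ g := by
  simp only [contourIntegral, smul_sub]
  exact intervalIntegral.integral_sub hf hg

theorem contourIntegral_congr {γ : ℝ → ℂ} {f g : ℂ → E}
    (h : ∀ t ∈ Icc (0 : ℝ) 1, f (γ t) = g (γ t)) : contourIntegral γ f = contourIntegral γ g := by
  refine intervalIntegral.integral_congr fun t ht => ?_
  rw [uIcc_of_le zero_le_one] at ht
  simp only [h t ht]

theorem contourIntegral_clm_comp [CompleteSpace E] {E' : Type*}
    [NormedAddCommGroup E'] [NormedSpace ℂ E'] [CompleteSpace E'] (T : E →L[ℂ] E')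
    {γ : ℝ → ℂ} {f : ℂ → E} (hf : ContourIntegrable γ f) :
    contourIntegral γ (fun z => T (f z)) = T (contourIntegral γ f) := by
  rw [contourIntegral, contourIntegral, ← T.intervalIntegral_comp_comm hf]
  simp

theorem contourIntegral_smul_const [CompleteSpace E] {γ : ℝ → ℂ} (f : ℂ → ℂ) (c : E) :
    contourIntegral γ (fun z => f z • c) = contourIntegral γ f • c := by
  simp only [contourIntegral, smul_smul, smul_eq_mul]
  exact intervalIntegral.integral_smul_const _ c

/-- The integral of an exact form along a loop vanishes. -/
theorem IsPiecewiseC1Loop.contourIntegral_eq_zero_of_hasDerivAt [CompleteSpace E] {γ : ℝ → ℂ}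
    (hγ : IsPiecewiseC1Loop γ) {f Φ : ℂ → E} {U : Set ℂ} (hf : ContinuousOn f U)
    (hU : ∀ t ∈ Icc (0 : ℝ) 1, γ t ∈ U) (hΦ : ∀ w ∈ U, HasDerivAt Φ (f w) w) :
    contourIntegral γ f = 0 := by
  obtain ⟨s, hs, -⟩ := hγ.2.2
  have := integral_eq_of_hasDerivAt_off_countable_of_le (fun t => Φ (γ t))
    (fun t => deriv γ t • f (γ t)) zero_le_one s.countable_toSet
    (fun t ht => ((hΦ _ (hU t ht)).continuousAt.comp_continuousWithinAt (hγ.2.1 t ht)))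
    (fun t ht => (hΦ _ (hU t (Ioo_subset_Icc_self ht.1))).scomp t (hs t ht).hasDerivAt)
    (hγ.contourIntegrable hf hU)
  rw [contourIntegral, this, hγ.1, sub_self]

/-- The winding number is unchanged under displacements smaller than the distance to the curve:
the difference of the two integrands has the primitive `log ((w - z) / (w - z₁))`. -/
theorem IsPiecewiseC1Loop.contourIntegral_inv_sub_eq {γ : ℝ → ℂ} (hγ : IsPiecewiseC1Loop γ)
    {z z₁ : ℂ} {U : Set ℂ} (hU : ∀ t ∈ Icc (0 : ℝ) 1, γ t ∈ U)
    (hz : ∀ w ∈ U, ‖z - z₁‖ < ‖w - z₁‖) :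
    contourIntegral γ (fun w => (w - z)⁻¹) = contourIntegral γ (fun w => (w - z₁)⁻¹) := by
  have h1 : ∀ w ∈ U, w - z₁ ≠ 0 := fun w hw h => by
    have := hz w hw
    rw [h, norm_zero] at this
    exact absurd this (norm_nonneg _).not_gt
  have h0 : ∀ w ∈ U, w - z ≠ 0 := fun w hw h => by
    have := hz w hw
    rw [← sub_eq_zero.1 h] at this
    exact lt_irrefl _ this
  have c0 : ContinuousOn (fun w : ℂ => (w - z)⁻¹) U :=
    (continuousOn_id.sub continuousOn_const).inv₀ h0
  have c1 : ContinuousOn (fun w : ℂ => (w - z₁)⁻¹) U :=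
    (continuousOn_id.sub continuousOn_const).inv₀ h1
  rw [← sub_eq_zero, ← contourIntegral_sub (hγ.contourIntegrable c0 hU)
    (hγ.contourIntegrable c1 hU)]
  refine hγ.contourIntegral_eq_zero_of_hasDerivAt (c0.sub c1) hU
    (Φ := fun w => Complex.log ((w - z) / (w - z₁))) fun w hw => ?_
  have hs : (w - z) / (w - z₁) ∈ Complex.slitPlane := by
    refine Complex.ball_one_subset_slitPlane ?_
    have : (w - z) / (w - z₁) - 1 = (z₁ - z) / (w - z₁) := by
      field_simp [h1 w hw]; ring
    rw [mem_ball, dist_eq_norm, this, norm_div, div_lt_one (norm_pos_iff.2 (h1 w hw)), norm_sub_rev]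
    exact hz w hw
  have hd : HasDerivAt (fun w : ℂ => (w - z) / (w - z₁))
      ((1 * (w - z₁) - (w - z) * 1) / (w - z₁) ^ 2) w :=
    ((hasDerivAt_id w).sub_const z).div ((hasDerivAt_id w).sub_const z₁) (h1 w hw)
  refine (hd.clog hs).congr_deriv ?_
  have h2 := h0 w hw
  have h3 := h1 w hw
  field_simp

/-- The winding number about points far away vanishes. -/
theorem IsPiecewiseC1Loop.contourIntegral_inv_sub_eq_zero {γ : ℝ → ℂ} (hγ : IsPiecewiseC1Loop γ)
    {z : ℂ} {U : Set ℂ} (hU : ∀ t ∈ Icc (0 : ℝ) 1, γ t ∈ U) (hz : ∀ w ∈ U, ‖w‖ < ‖z‖) :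
    contourIntegral γ (fun w => (w - z)⁻¹) = 0 := by
  have h0 : ∀ w ∈ U, w - z ≠ 0 := fun w hw h => by
    have := hz w hw
    rw [← sub_eq_zero.1 h] at this
    exact lt_irrefl _ this
  refine hγ.contourIntegral_eq_zero_of_hasDerivAt
    ((continuousOn_id.sub continuousOn_const).inv₀ h0) hU
    (Φ := fun w => Complex.log (1 - w / z)) fun w hw => ?_
  have hz0 : 0 < ‖z‖ := (norm_nonneg w).trans_lt (hz w hw)
  have hz0' : z ≠ 0 := norm_pos_iff.1 hz0
  have hs : 1 - w / z ∈ Complex.slitPlane := by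
    refine Complex.ball_one_subset_slitPlane ?_
    rw [mem_ball, dist_eq_norm, sub_sub_cancel_left, norm_neg, norm_div, div_lt_one hz0]
    exact hz w hw
  have hd : HasDerivAt (fun w : ℂ => 1 - w / z) (-(1 / z)) w :=
    ((hasDerivAt_id w).div_const z).const_sub 1
  refine (hd.clog hs).congr_deriv ?_
  have h2 := h0 w hw
  have h3 : 1 - w / z = -(w - z) / z := by field_simp; ring
  rw [h3]
  field_simp

/-- A bounded family of integrable functions that depends holomorphically on a parameter has a
holomorphic integral. -/
theorem differentiableOn_integral_of_bounded {μ : Measure ℝ} [IsFiniteMeasure μ]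
    {V : Set ℂ} (hV : IsOpen V) {φ : ℂ → ℝ → E} {C : ℝ}
    (hm : ∀ z ∈ V, AEStronglyMeasurable (φ z) μ)
    (hb : ∀ᵐ t ∂μ, ∀ z ∈ V, ‖φ z t‖ ≤ C)
    (hd : ∀ᵐ t ∂μ, DifferentiableOn ℂ (fun z => φ z t) V) :
    DifferentiableOn ℂ (fun z => ∫ t, φ z t ∂μ) V := by
  intro z₁ hz₁
  obtain ⟨r, hr, hrV⟩ := Metric.isOpen_iff.1 hV z₁ hz₁
  have hsub : ∀ x ∈ ball z₁ (r / 2), closedBall x (r / 4) ⊆ V := fun x hx y hy => hrV <| by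
    rw [mem_ball] at *
    rw [mem_closedBall] at hy
    linarith [dist_triangle y x z₁]
  refine ((hasDerivAt_integral_of_dominated_loc_of_deriv_le (𝕜 := ℂ) (μ := μ)
    (bound := fun _ => C / (r / 4)) (F := φ) (F' := fun z t => deriv (fun z => φ z t) z)
    (ball_mem_nhds z₁ (half_pos hr)) ?_ ?_ ?_ ?_
    (integrable_const _) ?_).2.differentiableAt).differentiableWithinAt
  · filter_upwards [hV.mem_nhds hz₁] with z hz using hm z hz
  · exact Integrable.of_bound (hm z₁ hz₁) C (hb.mono fun t ht => ht z₁ hz₁)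
  · -- the derivative is a limit of difference quotients along a sequence
    obtain ⟨u, hu, hu0, hulim⟩ : ∃ u : ℕ → ℂ, (∀ n, z₁ + u n ∈ V) ∧ (∀ n, u n ≠ 0) ∧
        Tendsto u atTop (𝓝 0) := by
      refine ⟨fun n => ((r / 2 * (1 / ((n : ℝ) + 1)) : ℝ) : ℂ), fun n => hrV ?_, fun n => ?_, ?_⟩
      · have h1 : 1 / ((n : ℝ) + 1) ≤ 1 := by
          rw [div_le_one (by positivity)]; linarith [(Nat.cast_nonneg n : (0 : ℝ) ≤ n)]
        have h0 : 0 ≤ 1 / ((n : ℝ) + 1) := by positivity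
        rw [mem_ball, dist_eq_norm, add_sub_cancel_left, Complex.norm_real, Real.norm_eq_abs,
          abs_of_nonneg (by positivity)]
        nlinarith
      · exact Complex.ofReal_ne_zero.2 (by positivity)
      · have := (tendsto_one_div_add_atTop_nhds_zero_nat (𝕜 := ℝ)).const_mul (r / 2)
        rw [mul_zero] at this
        exact_mod_cast (Complex.continuous_ofReal.tendsto 0).comp this
    refine aestronglyMeasurable_of_tendsto_ae atTop
      (f := fun n t => (u n)⁻¹ • (φ (z₁ + u n) t - φ z₁ t))
      (fun n => ((hm _ (hu n)).sub (hm _ hz₁)).const_smul _) ?_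
    filter_upwards [hd] with t ht
    have h := (ht.differentiableAt (hV.mem_nhds hz₁)).hasDerivAt.tendsto_slope_zero
    exact h.comp (tendsto_nhdsWithin_iff.2 ⟨hulim, Eventually.of_forall hu0⟩)
  · filter_upwards [hd, hb] with t ht htb x hx
    refine Complex.norm_deriv_le_of_forall_mem_sphere_norm_le (by positivity)
      ((ht.mono (hsub x hx)).diffContOnCl_ball subset_rfl)
      fun z hz => htb z (hsub x hx (sphere_subset_closedBall hz))
  · filter_upwards [hd] with t ht x hx
    exact (ht.differentiableAt (hV.mem_nhds
      (hsub x hx (mem_closedBall_self (by positivity))))).hasDerivAt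

theorem dslope_comm (f : ℂ → E) (a b : ℂ) : dslope f a b = dslope f b a := by
  rcases eq_or_ne a b with rfl | h
  · rfl
  · rw [dslope_of_ne _ h.symm, dslope_of_ne _ h, slope_comm]

/-- Difference quotients of a holomorphic function are locally bounded. -/
theorem exists_norm_dslope_le [CompleteSpace E] {f : ℂ → E} {U K : Set ℂ} (hU : IsOpen U)
    (hf : DifferentiableOn ℂ f U) (hK : IsCompact K) (hKU : K ⊆ U) {z₁ : ℂ} (hz₁ : z₁ ∈ U) :
    ∃ V, IsOpen V ∧ z₁ ∈ V ∧ V ⊆ U ∧ ∃ C, ∀ z ∈ V, ∀ w ∈ K, ‖dslope f z w‖ ≤ C := by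
  obtain ⟨r, hr, hrU⟩ := Metric.nhds_basis_closedBall.mem_iff.1 (hU.mem_nhds hz₁)
  have hcB : IsCompact (closedBall z₁ r) := isCompact_closedBall z₁ r
  obtain ⟨M, hM⟩ := (hK.union hcB).exists_bound_of_continuousOn
    (hf.continuousOn.mono (union_subset hKU hrU))
  obtain ⟨M', hM'⟩ := hcB.exists_bound_of_continuousOn ((hf.deriv hU).continuousOn.mono hrU)
  refine ⟨ball z₁ (r / 2), isOpen_ball, mem_ball_self (half_pos hr),
    (ball_subset_closedBall.trans (closedBall_subset_closedBall (by linarith))).trans hrU,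
    max M' ((r / 2)⁻¹ * (M + M)), fun z hz w hw => ?_⟩
  have hzr : z ∈ ball z₁ r := ball_subset_ball (by linarith) hz
  by_cases hwr : w ∈ ball z₁ r
  · refine le_max_of_le_left ?_
    rcases eq_or_ne w z with rfl | hne
    · rw [dslope_same]
      exact hM' w (ball_subset_closedBall hwr)
    · rw [dslope_of_ne _ hne, slope_def_module, norm_smul, norm_inv,
        inv_mul_le_iff₀ (norm_pos_iff.2 (sub_ne_zero.2 hne)), mul_comm]
      exact (convex_ball z₁ r).norm_image_sub_le_of_norm_deriv_le
        (fun x hx => hf.differentiableAt (hU.mem_nhds (hrU (ball_subset_closedBall hx))))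
        (fun x hx => hM' x (ball_subset_closedBall hx)) hzr hwr
  · refine le_max_of_le_right ?_
    have hne : r / 2 ≤ ‖w - z‖ := by
      rw [mem_ball, not_lt] at hwr
      rw [mem_ball] at hz
      rw [← dist_eq_norm]
      linarith [dist_triangle w z z₁]
    have hne' : w ≠ z := by
      rintro rfl
      simp at hne; linarith
    rw [dslope_of_ne _ hne', slope_def_module, norm_smul, norm_inv]
    refine mul_le_mul (inv_anti₀ (half_pos hr) hne) ((norm_sub_le _ _).trans (add_le_add ?_ ?_))
      (norm_nonneg _) (by positivity)
    · exact hM w (Or.inl hw)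
    · exact hM z (Or.inr (ball_subset_closedBall hzr))

/-- The homology form of Cauchy's theorem, by Dixon's argument: the function
`z ↦ ∮ (f w - f z) / (w - z) dw` extends to an entire function that vanishes at infinity. -/
theorem IsPiecewiseC1Loop.contourIntegral_eq_zero [CompleteSpace E] {γ : ℝ → ℂ}
    (hγ : IsPiecewiseC1Loop γ) {U : Set ℂ} (hU : IsOpen U) (hγU : ∀ t ∈ Icc (0 : ℝ) 1, γ t ∈ U)
    (hwind : ∀ w, w ∉ U → windingNumber γ w = 0) {f : ℂ → E} (hf : DifferentiableOn ℂ f U) :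
    contourIntegral γ f = 0 := by
  classical
  set K : Set ℂ := γ '' Icc 0 1
  have hK : IsCompact K := isCompact_Icc.image_of_continuousOn hγ.2.1
  have hKU : K ⊆ U := by rintro _ ⟨t, ht, rfl⟩; exact hγU t ht
  have hγK : ∀ t ∈ Icc (0 : ℝ) 1, γ t ∈ K := fun t ht => mem_image_of_mem _ ht
  -- the difference quotient of `w ↦ (w - γ 0) • f w` at `γ 0` is `f`, so it suffices to show that
  -- integrals of difference quotients vanish
  suffices key : ∀ g : ℂ → E, DifferentiableOn ℂ g U → ∀ z ∈ U,
      contourIntegral γ (dslope g z) = 0 by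
    have h0 : γ 0 ∈ U := hγU 0 (by simp)
    have hg : DifferentiableOn ℂ (fun w => (w - γ 0) • f w) U :=
      ((differentiable_id.sub_const _).differentiableOn).smul hf
    rw [← key _ hg (γ 0) h0]
    refine contourIntegral_congr fun t ht => ?_
    rcases eq_or_ne (γ t) (γ 0) with h | h
    · rw [h, dslope_same]
      have := ((hasDerivAt_id' (γ 0)).sub_const (γ 0)).fun_smul
        (hf.differentiableAt (hU.mem_nhds h0)).hasDerivAt
      simpa using this.deriv.symm
    · rw [dslope_of_ne _ h, slope_def_module]
      simp [smul_smul, inv_mul_cancel₀ (sub_ne_zero.2 h)]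
  clear hf f
  intro f hf z hz
  have hwind' : ∀ w, w ∉ U → contourIntegral γ (fun v => (v - w)⁻¹) = 0 := fun w hw => by
    have := hwind w hw
    rw [windingNumber, mul_eq_zero] at this
    refine this.resolve_left (inv_ne_zero ?_)
    simp [Real.pi_ne_zero]
  set h : ℂ → E := fun z => if z ∈ U then contourIntegral γ (dslope f z) else
    contourIntegral γ (fun w => (w - z)⁻¹ • f w) with hh
  have hcont : ∀ z ∉ K, ContinuousOn (fun w : ℂ => (w - z)⁻¹) K := fun z hz =>
    (continuousOn_id.sub continuousOn_const).inv₀ fun w hw =>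
      sub_ne_zero.2 fun e : w = z => hz (e ▸ hw)
  have hfK : ContinuousOn f K := hf.continuousOn.mono hKU
  -- off the curve, at points of winding number zero, both formulas agree
  have hagree : ∀ z ∉ K, contourIntegral γ (fun v => (v - z)⁻¹) = 0 →
      h z = contourIntegral γ (fun w => (w - z)⁻¹ • f w) := by
    intro z hz hz0
    by_cases hzU : z ∈ U
    · simp only [hh, if_pos hzU]
      have i1 : ContourIntegrable γ (fun w => (w - z)⁻¹ • f w) :=
        hγ.contourIntegrable ((hcont z hz).smul hfK) hγK
      have i2 : ContourIntegrable γ (fun w => (w - z)⁻¹ • f z) :=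
        hγ.contourIntegrable ((hcont z hz).smul continuousOn_const) hγK
      have := contourIntegral_sub i1 i2
      rw [contourIntegral_smul_const, hz0, zero_smul, sub_zero] at this
      rw [← this]
      refine contourIntegral_congr fun t ht => ?_
      have hne : γ t ≠ z := fun e => hz (e ▸ hγK t ht)
      rw [dslope_of_ne _ hne, slope_def_module, smul_sub]
    · simp only [hh, if_neg hzU]
  obtain ⟨C, hC0, hC⟩ := hγ.exists_ae_bound
  have hmem : ∀ᵐ t ∂(volume.restrict (Ioc (0 : ℝ) 1)), t ∈ Icc (0 : ℝ) 1 := by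
    filter_upwards [ae_restrict_mem measurableSet_Ioc] with t ht using Ioc_subset_Icc_self ht
  have hdiff : Differentiable ℂ h := by
    intro z₁
    by_cases hz₁ : z₁ ∈ U
    · obtain ⟨V, hV, hz₁V, hVU, C', hC'⟩ := exists_norm_dslope_le hU hf hK hKU hz₁
      have : DifferentiableOn ℂ (fun z => ∫ t in Ioc (0 : ℝ) 1, deriv γ t • dslope f z (γ t)) V := by
        refine differentiableOn_integral_of_bounded (C := C * C') hV (fun z hz => ?_) ?_ ?_
        · refine (hγ.integrable_smul (ContinuousOn.comp (t := U) ?_ hγ.2.1 hγU)).1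
          exact (continuousOn_dslope (hU.mem_nhds (hVU hz))).2
            ⟨hf.continuousOn, hf.differentiableAt (hU.mem_nhds (hVU hz))⟩
        · filter_upwards [hC, hmem] with t ht ht' z hz
          rw [norm_smul]
          exact mul_le_mul ht (hC' z hz _ (hγK t ht')) (norm_nonneg _) hC0
        · filter_upwards [hmem] with t ht
          refine DifferentiableOn.const_smul ?_ _
          simp only [fun z => dslope_comm f z (γ t)]
          exact ((Complex.differentiableOn_dslope (hU.mem_nhds (hγU t ht))).2 hf).mono hVU
      refine (this.differentiableAt (hV.mem_nhds hz₁V)).congr_of_eventuallyEq ?_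
      filter_upwards [hV.mem_nhds hz₁V] with z hz
      simp only [hh, if_pos (hVU hz), contourIntegral, intervalIntegral.integral_of_le zero_le_one]
    · have hz₁K : z₁ ∉ K := fun h => hz₁ (hKU h)
      obtain ⟨r, hr, hrK⟩ := Metric.isOpen_iff.1 hK.isClosed.isOpen_compl z₁ hz₁K
      obtain ⟨M, hM⟩ := hK.exists_bound_of_continuousOn hfK
      have hfar : ∀ w ∈ K, r ≤ ‖w - z₁‖ := fun w hw => by
        by_contra hlt
        exact hrK (mem_ball.2 (by rw [dist_eq_norm]; exact not_le.1 hlt)) hw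
      have hsub : ∀ z ∈ ball z₁ (r / 2), z ∉ K := fun z hz =>
        hrK (ball_subset_ball (by linarith) hz)
      have : DifferentiableOn ℂ
          (fun z => ∫ t in Ioc (0 : ℝ) 1, deriv γ t • (γ t - z)⁻¹ • f (γ t)) (ball z₁ (r / 2)) := by
        refine differentiableOn_integral_of_bounded (C := C * ((r / 2)⁻¹ * M)) isOpen_ball
          (fun z hz => ?_) ?_ ?_
        · exact (hγ.integrable_smul
            (ContinuousOn.comp (t := K) ((hcont z (hsub z hz)).smul hfK) hγ.2.1 hγK)).1
        · filter_upwards [hC, hmem] with t ht ht' z hz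
          rw [norm_smul, norm_smul, norm_inv]
          have h1 : r / 2 ≤ ‖γ t - z‖ := by
            have := hfar _ (hγK t ht')
            rw [mem_ball] at hz
            rw [← dist_eq_norm] at this ⊢
            linarith [dist_triangle (γ t) z z₁]
          have h2 := hM _ (hγK t ht')
          gcongr
        · filter_upwards [hmem] with t ht
          refine DifferentiableOn.const_smul (DifferentiableOn.smul_const ?_ _) _
          refine DifferentiableOn.inv
            ((differentiable_const _).sub differentiable_id).differentiableOn fun z hz => sub_ne_zero.2 fun e : γ t = z => hsub z hz ?_
          rw [← e]; exact hγK t ht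
      refine (this.differentiableAt
        (ball_mem_nhds z₁ (half_pos hr))).congr_of_eventuallyEq ?_
      filter_upwards [ball_mem_nhds z₁ (half_pos hr)] with z hz
      rw [hagree z (hsub z hz)]
      · simp only [contourIntegral, intervalIntegral.integral_of_le zero_le_one]
      · rw [hγ.contourIntegral_inv_sub_eq hγK (z₁ := z₁), hwind' z₁ hz₁]
        intro w hw
        rw [mem_ball, dist_eq_norm] at hz
        linarith [hfar w hw]
  obtain ⟨M, hM⟩ := hK.exists_bound_of_continuousOn hfK
  obtain ⟨ρ, hρ⟩ := hK.exists_bound_of_continuousOn (f := fun w => w) continuousOn_id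
  have hlim : Tendsto h (cocompact ℂ) (𝓝 0) := by
    have hbd : ∀ᶠ z in cocompact ℂ, ‖h z‖ ≤ C * ((‖z‖ - ρ)⁻¹ * M) := by
      filter_upwards [(tendsto_norm_cocompact_atTop (E := ℂ)).eventually_gt_atTop ρ] with z hz
      have hzK : z ∉ K := fun hmem => (hρ z hmem).not_gt hz
      rw [hagree z hzK (hγ.contourIntegral_inv_sub_eq_zero hγK
        fun w hw => (hρ w hw).trans_lt hz), contourIntegral,
        intervalIntegral.integral_of_le zero_le_one]
      refine (norm_integral_le_of_norm_le_const (C := C * ((‖z‖ - ρ)⁻¹ * M)) ?_).trans ?_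
      · filter_upwards [hC, hmem] with t ht ht'
        rw [norm_smul, norm_smul, norm_inv]
        have h1 : ‖z‖ - ρ ≤ ‖γ t - z‖ := by
          rw [norm_sub_rev]
          linarith [norm_sub_norm_le z (γ t), hρ _ (hγK t ht')]
        have h2 := hM _ (hγK t ht')
        have h3 : 0 < ‖z‖ - ρ := by linarith
        gcongr
      · simp
    refine squeeze_zero_norm' hbd ?_
    have h1 : Tendsto (fun z : ℂ => (‖z‖ - ρ)⁻¹) (cocompact ℂ) (𝓝 0) :=
      (tendsto_atTop_add_const_right _ (-ρ)
        (tendsto_norm_cocompact_atTop (E := ℂ))).inv_tendsto_atTop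
    simpa using (h1.mul_const M).const_mul C
  have := hdiff.apply_eq_of_tendsto_cocompact z hlim
  simpa only [hh, if_pos hz] using this

/-- Cauchy's theorem for a function with a removable singularity at `z₀`; the value of `f` at `z₀`
plays no role. -/
theorem IsPiecewiseC1Loop.contourIntegral_eq_zero_of_removable [CompleteSpace E] {γ : ℝ → ℂ}
    (hγ : IsPiecewiseC1Loop γ) {U : Set ℂ} (hU : IsOpen U) (hγU : ∀ t ∈ Icc (0 : ℝ) 1, γ t ∈ U)
    (hwind : ∀ w, w ∉ U → windingNumber γ w = 0) {z₀ : ℂ}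
    (hz₀ : ∀ t ∈ Icc (0 : ℝ) 1, γ t ≠ z₀) {f H : ℂ → E}
    (hf : ∀ w ∈ U, w ≠ z₀ → AnalyticAt ℂ f w) (hH : AnalyticAt ℂ H z₀) (hfH : f =ᶠ[𝓝[≠] z₀] H) :
    contourIntegral γ f = 0 := by
  classical
  have hd : DifferentiableOn ℂ (Function.update f z₀ (H z₀)) U := by
    intro w hw
    rcases eq_or_ne w z₀ with rfl | hne
    · refine (hH.differentiableAt.congr_of_eventuallyEq ?_).differentiableWithinAt
      replace hfH := eventually_nhdsWithin_iff.1 hfH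
      filter_upwards [hfH] with z hz
      rcases eq_or_ne z w with rfl | h
      · simp
      · rw [Function.update_of_ne h]; exact hz h
    · refine ((hf w hw hne).differentiableAt.congr_of_eventuallyEq ?_).differentiableWithinAt
      filter_upwards [isOpen_ne.mem_nhds hne] with z hz
      rw [Function.update_of_ne hz]
  rw [← hγ.contourIntegral_eq_zero hU hγU hwind hd]
  exact contourIntegral_congr fun t ht => by rw [Function.update_of_ne (hz₀ t ht)]

end Cauchy

/-! ### Principal parts and the identity principle -/

section PrincipalParts

variable {E F G : Type*} [NormedAddCommGroup E] [NormedSpace ℂ E]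
  [NormedAddCommGroup F] [NormedSpace ℂ F] [NormedAddCommGroup G] [NormedSpace ℂ G]

theorem analyticAt_clm_comp {f : ℂ → F →L[ℂ] G} {g : ℂ → E →L[ℂ] F} {w : ℂ}
    (hf : AnalyticAt ℂ f w) (hg : AnalyticAt ℂ g w) :
    AnalyticAt ℂ (fun z => f z ∘L g z) w :=
  ((ContinuousLinearMap.compL ℂ E F G).analyticAt_bilinear (f w, g w)).comp₂ hf hg

theorem analyticAt_clm_apply_const {f : ℂ → E} {w : ℂ} (T : E →L[ℂ] F) (hf : AnalyticAt ℂ f w) :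
    AnalyticAt ℂ (fun z => T (f z)) w :=
  (T.analyticAt (f w)).comp hf

theorem meromorphicAt_clm_apply {f : ℂ → E} {w : ℂ} (T : E →L[ℂ] F) (hf : MeromorphicAt f w) :
    MeromorphicAt (fun z => T (f z)) w := by
  obtain ⟨n, hn⟩ := hf
  refine ⟨n, (analyticAt_clm_apply_const T hn).congr (Eventually.of_forall fun z => ?_)⟩
  simp

theorem meromorphicAt_clm_comp_analyticAt {f : ℂ → F →L[ℂ] G} {g : ℂ → E →L[ℂ] F} {w : ℂ}
    (hf : MeromorphicAt f w) (hg : AnalyticAt ℂ g w) :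
    MeromorphicAt (fun z => f z ∘L g z) w := by
  obtain ⟨n, hn⟩ := hf
  refine ⟨n, (analyticAt_clm_comp hn hg).congr (Eventually.of_forall fun z => ?_)⟩
  simp

theorem analyticAt_clm_comp_meromorphicAt {f : ℂ → F →L[ℂ] G} {g : ℂ → E →L[ℂ] F} {w : ℂ}
    (hf : AnalyticAt ℂ f w) (hg : MeromorphicAt g w) :
    MeromorphicAt (fun z => f z ∘L g z) w := by
  obtain ⟨n, hn⟩ := hg
  refine ⟨n, (analyticAt_clm_comp hf hn).congr (Eventually.of_forall fun z => ?_)⟩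
  simp

/-- If every component of `U` meets the open set `D`, a meromorphic function on `U` that vanishes
on `D` vanishes. -/
theorem eventually_eq_zero_of_eq_zero_on {f : ℂ → E} {D U : Set ℂ} (hD : IsOpen D)
    (hconn : ∀ w ∈ U, (connectedComponentIn U w ∩ D).Nonempty) (hf : MeromorphicOn f U)
    (h0 : ∀ z ∈ D, f z = 0) {w : ℂ} (hw : w ∈ U) : ∀ᶠ z in 𝓝[≠] w, f z = 0 := by
  obtain ⟨v, hv, hvD⟩ := hconn w hw
  rw [← meromorphicOrderAt_eq_top_iff]
  by_contra hne
  refine (hf.mono_set (connectedComponentIn_subset U w)).meromorphicOrderAt_ne_top_of_isPreconnected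
    isPreconnected_connectedComponentIn (mem_connectedComponentIn hw) hv hne ?_
  rw [meromorphicOrderAt_eq_top_iff]
  exact Filter.Eventually.filter_mono nhdsWithin_le_nhds
    (eventually_of_mem (hD.mem_nhds hvD) h0)

theorem eq_zero_of_eventually_eq_zero {V : Type*} [NormedAddCommGroup V] {f : ℂ → V} {w : ℂ}
    (hf : ContinuousAt f w)
    (h : ∀ᶠ z in 𝓝[≠] w, f z = 0) : f w = 0 :=
  tendsto_nhds_unique_of_eventuallyEq (hf.tendsto.mono_left nhdsWithin_le_nhds)
    tendsto_const_nhds h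

/-- The function `∑_{1 ≤ j ≤ L} (z - w)⁻ʲ A j` of `z`, with the indexing of `HasPrincipalPart`:
`A j` is the coefficient of index `-j`, and `A 0` does not enter. -/
def principalPart (A : ℕ → E) (L : ℕ) (w z : ℂ) : E :=
  ∑ j ∈ Finset.Icc 1 L, ((z - w) ^ j)⁻¹ • A j

theorem analyticAt_principalPart (A : ℕ → E) (L : ℕ) {w z : ℂ} (hz : z ≠ w) :
    AnalyticAt ℂ (principalPart A L w) z := by
  refine Finset.analyticAt_fun_sum _ fun j _ =>
    AnalyticAt.smul (AnalyticAt.inv ?_ ?_) analyticAt_const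
  · exact (analyticAt_id.sub analyticAt_const).pow j
  · exact pow_ne_zero _ (sub_ne_zero.2 hz)

theorem meromorphicAt_principalPart (A : ℕ → E) (L : ℕ) (w z : ℂ) :
    MeromorphicAt (principalPart A L w) z := by
  refine MeromorphicAt.fun_sum fun j _ => MeromorphicAt.smul (MeromorphicAt.inv ?_) (.const _ _)
  exact ((MeromorphicAt.id z).sub (.const w z)).pow j

theorem clm_principalPart (T : E →L[ℂ] F) (A : ℕ → E) (L : ℕ) (w z : ℂ) :
    T (principalPart A L w z) = principalPart (fun j => T (A j)) L w z := by
  simp [principalPart]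

theorem HasPrincipalPart.meromorphicAt {f : ℂ → E} {w : ℂ} {L : ℕ} {A : ℕ → E}
    (h : HasPrincipalPart f w L A) : MeromorphicAt f w := by
  obtain ⟨-, H, hH, hf⟩ := h
  refine MeromorphicAt.congr (f := principalPart A L w + H)
    ((meromorphicAt_principalPart A L w w).add hH.meromorphicAt) ?_
  filter_upwards [hf] with z hz using hz.symm

/-- Multiplication by `z - w` shifts the coefficients of a principal part. -/
theorem sub_smul_principalPart (A : ℕ → E) (L : ℕ) {w z : ℂ} (hz : z ≠ w) :
    (z - w) • principalPart A L w z + ((z - w) ^ L)⁻¹ • A (L + 1) =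
      principalPart (fun j => A (j + 1)) L w z + A 1 := by
  have h0 : z - w ≠ 0 := sub_ne_zero.2 hz
  induction L with
  | zero => simp [principalPart]
  | succ L ih =>
    rw [principalPart, Finset.sum_Icc_succ_top (by omega), principalPart,
      Finset.sum_Icc_succ_top (by omega), ← principalPart, ← principalPart, smul_add, smul_smul,
      pow_succ, mul_inv, mul_left_comm, mul_inv_cancel₀ h0, mul_one, ih]
    abel

/-- Uniqueness of Laurent expansions with finite principal part. -/
theorem coeff_eq_zero_of_principalPart_add_eq_zero {L : ℕ} {A : ℕ → E} {w : ℂ} {H : ℂ → E}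
    (hH : ContinuousAt H w) (h : ∀ᶠ z in 𝓝[≠] w, principalPart A L w z + H z = 0) :
    ∀ j ∈ Finset.Icc 1 L, A j = 0 := by
  induction L with
  | zero => simp
  | succ L ih =>
    have hlast : A (L + 1) = 0 := by
      -- `(z - w) ^ (L + 1)` times the relation is continuous, with value `A (L + 1)` at `w`
      have hc : ContinuousAt (fun z => (∑ j ∈ Finset.Icc 1 L, (z - w) ^ (L + 1 - j) • A j) +
          A (L + 1) + (z - w) ^ (L + 1) • H z) w := by
        refine ContinuousAt.add (Continuous.continuousAt (by fun_prop)) (ContinuousAt.smul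
          (Continuous.continuousAt (by fun_prop)) hH)
      have hz : ∀ᶠ z in 𝓝[≠] w, (∑ j ∈ Finset.Icc 1 L, (z - w) ^ (L + 1 - j) • A j) + A (L + 1) +
          (z - w) ^ (L + 1) • H z = 0 := by
        filter_upwards [h, self_mem_nhdsWithin] with z hz hne
        have h0 : z - w ≠ 0 := sub_ne_zero.2 hne
        have := congrArg (fun v => (z - w) ^ (L + 1) • v) hz
        simp only [smul_zero, smul_add] at this
        rw [principalPart, Finset.sum_Icc_succ_top (by omega), smul_add, smul_smul,
          mul_inv_cancel₀ (pow_ne_zero _ h0), one_smul, Finset.smul_sum] at this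
        rw [← this]
        congr 2
        refine Finset.sum_congr rfl fun j hj => ?_
        rw [Finset.mem_Icc] at hj
        rw [smul_smul, pow_sub₀ _ h0 (by omega)]
      have := eq_zero_of_eventually_eq_zero hc hz
      simp only [sub_self] at this
      rw [Finset.sum_eq_zero, zero_pow (by omega), zero_smul, zero_add, add_zero] at this
      · exact this
      · intro j hj
        rw [Finset.mem_Icc] at hj
        rw [zero_pow (by omega), zero_smul]
    intro j hj
    rw [Finset.mem_Icc] at hj
    rcases eq_or_lt_of_le hj.2 with rfl | hlt
    · exact hlast
    · refine ih ?_ j (Finset.mem_Icc.2 ⟨hj.1, by omega⟩)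
      filter_upwards [h] with z hz
      rw [principalPart, Finset.sum_Icc_succ_top (by omega), hlast, smul_zero, add_zero] at hz
      exact hz

theorem principalPart_of_le {A : ℕ → E} {L M : ℕ} (hA : ∀ j, L < j → A j = 0) (hLM : L ≤ M)
    (w z : ℂ) : principalPart A M w z = principalPart A L w z := by
  refine (Finset.sum_subset (Finset.Icc_subset_Icc_right hLM) fun j hj hj' => ?_).symm
  rw [hA j, smul_zero]
  simp only [Finset.mem_Icc] at hj hj'
  omega

theorem HasPrincipalPart.coeff_unique {f : ℂ → E} {w : ℂ} {L M : ℕ} {A B : ℕ → E}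
    (h : HasPrincipalPart f w L A) (h' : HasPrincipalPart f w M B) {j : ℕ} (hj : 1 ≤ j) :
    A j = B j := by
  obtain ⟨hA, H, hH, hf⟩ := h
  obtain ⟨hB, K, hK, hf'⟩ := h'
  by_cases hjm : j ≤ max L M
  · refine sub_eq_zero.1 (coeff_eq_zero_of_principalPart_add_eq_zero (A := fun j => A j - B j)
      (L := max L M) (hH.sub hK).continuousAt ?_ j (Finset.mem_Icc.2 ⟨hj, hjm⟩))
    filter_upwards [hf, hf'] with z hz hz'
    have e : principalPart (fun j => A j - B j) (max L M) w z =
        principalPart A L w z - principalPart B M w z := by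
      rw [← principalPart_of_le hA (le_max_left L M), ← principalPart_of_le hB (le_max_right L M)]
      simp [principalPart, smul_sub]
    rw [e, Pi.sub_apply, principalPart, principalPart]
    have := hz.symm.trans hz'
    rw [← sub_eq_zero] at this
    rw [← this]
    abel
  · rw [hA j (by omega), hB j (by omega)]

/-- A linear relation between `f z`, `z • f z` and a constant passes to the Laurent
coefficients. -/
theorem HasPrincipalPart.coeff_relation {f : ℂ → E} {w : ℂ} {L : ℕ} {A : ℕ → E}
    (h : HasPrincipalPart f w L A) (T₁ T₂ : E →L[ℂ] F) (c : F)
    (hrel : ∀ᶠ z in 𝓝[≠] w, T₁ (f z) + z • T₂ (f z) + c = 0) {j : ℕ} (hj : 1 ≤ j) :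
    T₁ (A j) + w • T₂ (A j) + T₂ (A (j + 1)) = 0 := by
  obtain ⟨hA, H, hH, hf⟩ := h
  by_cases hjL : j ≤ L
  · refine coeff_eq_zero_of_principalPart_add_eq_zero
      (A := fun j => T₁ (A j) + w • T₂ (A j) + T₂ (A (j + 1))) (L := L) (w := w)
      (H := fun z => T₁ (H z) + z • T₂ (H z) + c + T₂ (A 1)) ?_ ?_ j (Finset.mem_Icc.2 ⟨hj, hjL⟩)
    · have h1 := (T₁.continuous.continuousAt (x := H w)).comp hH.continuousAt
      have h2 := (T₂.continuous.continuousAt (x := H w)).comp hH.continuousAt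
      exact ((h1.add (continuousAt_id.smul h2)).add continuousAt_const).add continuousAt_const
    · filter_upwards [hf, hrel, self_mem_nhdsWithin] with z hz hr hne
      have e : principalPart (fun j => T₁ (A j) + w • T₂ (A j) + T₂ (A (j + 1))) L w z =
          T₁ (principalPart A L w z) + w • T₂ (principalPart A L w z) +
            principalPart (fun j => T₂ (A (j + 1))) L w z := by
        rw [clm_principalPart, clm_principalPart]
        simp only [principalPart, smul_add, Finset.sum_add_distrib, Finset.smul_sum]
        congr 2
        exact Finset.sum_congr rfl fun j _ => smul_comm _ _ _
      have e2 := sub_smul_principalPart (fun j => T₂ (A j)) L hne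
      rw [hA (L + 1) (by omega), map_zero, smul_zero, add_zero, ← clm_principalPart] at e2
      rw [← principalPart] at hz
      rw [hz, map_add, map_add] at hr
      rw [e, ← hr, ← sub_eq_iff_eq_add.2 e2]
      module
  · rw [hA j (by omega), hA (j + 1) (by omega)]
    simp

theorem eventually_ne_isPole {f : ℂ → E} [CompleteSpace E] {w : ℂ} (hf : MeromorphicAt f w) :
    ∀ᶠ z in 𝓝[≠] w, ¬ IsPole f z := by
  filter_upwards [hf.eventually_analyticAt] with z hz hp
  exact hp.2.not_ge hz.meromorphicOrderAt_nonneg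

end PrincipalParts

/-! ### Traces -/

section Trace

variable {X W : Type*} [NormedAddCommGroup X] [NormedSpace ℂ X]
  [AddCommGroup W] [Module ℂ W] [Module.Finite ℂ W]

/-- The trace of an operator that factors through a finite-dimensional space. -/
theorem finiteRankTrace_eq_trace_comp (T : X →L[ℂ] X) (φ : X →ₗ[ℂ] W) (ψ : W →ₗ[ℂ] X)
    (hT : T.toLinearMap = ψ ∘ₗ φ) : finiteRankTrace T = LinearMap.trace ℂ W (φ ∘ₗ ψ) := by
  set V := LinearMap.range T.toLinearMap with hV
  set V' := LinearMap.range (φ ∘ₗ ψ) with hV'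
  have hTx : ∀ x, T.toLinearMap x = ψ (φ x) := fun x => by rw [hT]; rfl
  have hfin : Module.Finite ℂ V := by
    rw [hV, hT]
    exact Module.Finite.of_surjective
      (LinearMap.restrict ψ (p := LinearMap.range φ) (q := LinearMap.range (ψ ∘ₗ φ))
        (by rintro _ ⟨x, rfl⟩; exact ⟨x, rfl⟩))
      (by rintro ⟨_, x, rfl⟩; exact ⟨⟨φ x, x, rfl⟩, rfl⟩)
  let α : V →ₗ[ℂ] V' := φ.restrict (p := V) (q := V')
    (by rintro _ ⟨x, rfl⟩; exact ⟨φ x, by rw [hTx]; rfl⟩)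
  let β : V' →ₗ[ℂ] V := ψ.restrict (p := V') (q := V)
    (by rintro _ ⟨y, rfl⟩; exact ⟨ψ y, by rw [hTx]; rfl⟩)
  have h1 : finiteRankTrace T = LinearMap.trace ℂ V (β ∘ₗ α) := by
    rw [finiteRankTrace]
    congr 1
    ext x
    exact hTx x
  rw [h1, LinearMap.trace_comp_comm', ← LinearMap.trace_restrict_eq_of_forall_mem V' (φ ∘ₗ ψ)
    fun x => LinearMap.mem_range_self _ x]
  rfl

/-- A principal part built from the powers of a nilpotent operator has the trace of the identity
over `z - w`. -/
theorem trace_principalPart_pow {W : Type*} [NormedAddCommGroup W] [NormedSpace ℂ W]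
    [FiniteDimensional ℂ W] {N : W →L[ℂ] W} {L : ℕ} (hN : N ^ L = 0) (w z : ℂ) :
    LinearMap.trace ℂ W (principalPart (fun j => N ^ (j - 1)) L w z).toLinearMap =
      (z - w)⁻¹ * Module.finrank ℂ W := by
  have htr : ∀ k, 1 ≤ k → LinearMap.trace ℂ W (N ^ k).toLinearMap = 0 := by
    intro k hk
    have : IsNilpotent (N ^ k).toLinearMap := by
      refine ⟨L, ?_⟩
      rw [← ContinuousLinearMap.toLinearMap_pow, ← pow_mul, mul_comm, pow_mul, hN,
        zero_pow (by omega)]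
      rfl
    exact (LinearMap.isNilpotent_trace_of_isNilpotent this).eq_zero
  rcases Nat.eq_zero_or_pos L with rfl | hL
  · have : Subsingleton W := by
      refine ⟨fun x y => ?_⟩
      have hx : ∀ v : W, v = 0 := fun v => by
        have := congrArg (fun T : W →L[ℂ] W => T v) hN
        simpa using this
      rw [hx x, hx y]
    simp [principalPart, Module.finrank_zero_of_subsingleton]
  · have e : (principalPart (fun j => N ^ (j - 1)) L w z).toLinearMap =
        ∑ j ∈ Finset.Icc 1 L, ((z - w) ^ j)⁻¹ • (N ^ (j - 1)).toLinearMap := by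
      ext v
      simp [principalPart]
    rw [e, map_sum, Finset.sum_eq_single 1]
    · have : (N ^ (1 - 1)).toLinearMap = LinearMap.id := rfl
      rw [this, map_smul, LinearMap.trace_id, pow_one, smul_eq_mul]
    · intro j hj hj1
      rw [Finset.mem_Icc] at hj
      rw [map_smul, htr _ (by omega), smul_zero]
    · intro h
      exact absurd (Finset.mem_Icc.2 ⟨le_rfl, hL⟩) h

end Trace

/-! ### The principal part at the pole -/

section Structure

variable {X Y : Type*} [NormedAddCommGroup X] [NormedSpace ℂ X]
  [NormedAddCommGroup Y] [NormedSpace ℂ Y]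

/-- If the coefficients of a principal part form a chain, then they are `N ^ (j - 1) ∘ A 1` for a
nilpotent operator `N` on the range of `A 1`. -/
theorem exists_nilpotent_of_chain {A : ℕ → X →L[ℂ] Y} {L : ℕ} (hA : ∀ j, L < j → A j = 0)
    [FiniteDimensional ℂ (LinearMap.range (A 1).toLinearMap)]
    (hchain : ∀ j, 1 ≤ j → ∀ u v, A j u = A 1 v → A (j + 1) u = A 2 v)
    (hran : ∀ u, A 2 u ∈ LinearMap.range (A 1).toLinearMap) :
    ∃ N : LinearMap.range (A 1).toLinearMap →L[ℂ] LinearMap.range (A 1).toLinearMap,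
      N ^ L = 0 ∧ ∀ j, 1 ≤ j → ∀ u,
        A j u = (N ^ (j - 1)) ⟨A 1 u, LinearMap.mem_range_self (A 1).toLinearMap u⟩ := by
  set a := (A 1).toLinearMap.rangeRestrict
  obtain ⟨s, hs⟩ := a.exists_rightInverse_of_surjective (LinearMap.range_rangeRestrict _)
  have hs' : ∀ w, A 1 (s w) = w := fun w =>
    congrArg Subtype.val (LinearMap.congr_fun hs w)
  set N := LinearMap.toContinuousLinearMap
    (((A 2).toLinearMap.codRestrict (LinearMap.range (A 1).toLinearMap) hran) ∘ₗ s)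
  have hNa : ∀ w, (N w : Y) = A 2 (s w) := fun w => rfl
  have hpow : ∀ k u, A (k + 1) u =
      (N ^ k) ⟨A 1 u, LinearMap.mem_range_self (A 1).toLinearMap u⟩ := by
    intro k
    induction k with
    | zero => intro u; rfl
    | succ k ih =>
      intro u
      rw [pow_succ', mul_apply_eq_comp, hNa]
      exact hchain (k + 1) (by omega) u _ (by rw [hs', ih])
  refine ⟨N, ?_, fun j hj u => ?_⟩
  · ext ⟨_, u, rfl⟩
    have := hpow L u
    rw [hA (L + 1) (by omega)] at this
    exact this.symm
  · obtain ⟨k, rfl⟩ : ∃ k, j = k + 1 := ⟨j - 1, by omega⟩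
    exact hpow k u

/-- For nilpotent `N`, the principal part with coefficients `N ^ (j - 1)` is the resolvent
`(z - w - N)⁻¹`. -/
theorem sub_smul_principalPart_pow {N : X →L[ℂ] X} {L : ℕ} (hN : N ^ L = 0) {w z : ℂ}
    (hz : z ≠ w) :
    (z - w) • principalPart (fun j => N ^ (j - 1)) L w z =
      N * principalPart (fun j => N ^ (j - 1)) L w z + 1 ∧
    (z - w) • principalPart (fun j => N ^ (j - 1)) L w z =
      principalPart (fun j => N ^ (j - 1)) L w z * N + 1 := by
  have h := sub_smul_principalPart (fun j => N ^ (j - 1)) L hz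
  simp only [Nat.add_sub_cancel, hN, smul_zero, add_zero, Nat.sub_self, pow_zero] at h
  rw [h]
  have e : ∀ j ∈ Finset.Icc 1 L, N ^ j = N * N ^ (j - 1) ∧ N ^ j = N ^ (j - 1) * N := by
    intro j hj
    rw [Finset.mem_Icc] at hj
    obtain ⟨k, rfl⟩ : ∃ k, j = k + 1 := ⟨j - 1, by omega⟩
    exact ⟨pow_succ' N k, pow_succ N k⟩
  constructor
  · congr 1
    rw [principalPart, principalPart, Finset.mul_sum]
    exact Finset.sum_congr rfl fun j hj => by rw [(e j hj).1, mul_smul_comm]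
  · congr 1
    rw [principalPart, principalPart, Finset.sum_mul]
    exact Finset.sum_congr rfl fun j hj => by rw [(e j hj).2, smul_mul_assoc]

/-- The trace as a continuous functional on the operators of a finite-dimensional space. -/
def traceL (W : Type*) [NormedAddCommGroup W] [NormedSpace ℂ W] [FiniteDimensional ℂ W] :
    (W →L[ℂ] W) →L[ℂ] ℂ :=
  LinearMap.toContinuousLinearMap (LinearMap.trace ℂ W ∘ₗ ContinuousLinearMap.coeLM ℂ)

theorem traceL_apply {W : Type*} [NormedAddCommGroup W] [NormedSpace ℂ W]
    [FiniteDimensional ℂ W] (T : W →L[ℂ] W) : traceL W T = LinearMap.trace ℂ W T.toLinearMap :=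
  rfl

theorem traceL_comp_comm {W : Type*} [NormedAddCommGroup W] [NormedSpace ℂ W]
    [FiniteDimensional ℂ W] (T T' : W →L[ℂ] W) : traceL W (T ∘L T') = traceL W (T' ∘L T) :=
  LinearMap.trace_mul_comm ℂ T.toLinearMap T'.toLinearMap

/-- The local trace computation. Let the principal part of `R` at `z₀` be `j ∘ m ∘ a` with
`m z = (z - z₀ - N)⁻¹`. By the two resolvent identities, the products `K = m a (1 + S R₀)` and
`G = (1 + R₀ S) j m` are regular at `z₀` in spite of the singular factor `m`; here `π` is a left
inverse of `j`. Differentiating `(z - z₀ - N) K = a (1 + S R₀)` turns `m a S R₀'` into `m K + K'`, and `K S j m = m a S G = π (G - H S G) - m`. So the trace of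
`m a S R₀' S j` is that of `-m` up to an analytic function. -/
theorem exists_analyticAt_trace_eq [CompleteSpace X] [CompleteSpace Y] {S : Y →L[ℂ] X}
    {R R₀ H : ℂ → X →L[ℂ] Y}
    {W : Type*} [NormedAddCommGroup W] [NormedSpace ℂ W] [FiniteDimensional ℂ W]
    {j : W →L[ℂ] Y} {π : Y →L[ℂ] W} (hπ : ∀ w, π (j w) = w) {a : X →L[ℂ] W}
    (ha : Function.Surjective a) {N : W →L[ℂ] W} {m : ℂ → W →L[ℂ] W} {z₀ : ℂ}
    (hm : ∀ z, z ≠ z₀ → (z - z₀) • m z = N * m z + 1)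
    (hm' : ∀ z, z ≠ z₀ → (z - z₀) • m z = m z * N + 1)
    (hR₀ : AnalyticAt ℂ R₀ z₀) (hH : AnalyticAt ℂ H z₀)
    (hR : ∀ᶠ z in 𝓝[≠] z₀, R z = j ∘L m z ∘L a + H z)
    (hRF : ∀ᶠ z in 𝓝[≠] z₀, R z + R z ∘L S ∘L R₀ z = R₀ z)
    (hFR : ∀ᶠ z in 𝓝[≠] z₀, R z + R₀ z ∘L S ∘L R z = R₀ z) :
    ∃ h : ℂ → ℂ, AnalyticAt ℂ h z₀ ∧ ∀ᶠ z in 𝓝[≠] z₀,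
      traceL W (m z ∘L a ∘L S ∘L deriv R₀ z ∘L S ∘L j) = h z - traceL W (m z) := by
  obtain ⟨s, hs⟩ := a.toLinearMap.exists_rightInverse_of_surjective (LinearMap.range_eq_top.2 ha)
  set σ : W →L[ℂ] X := LinearMap.toContinuousLinearMap s
  have hσa : ∀ w, a (σ w) = w := fun w => LinearMap.congr_fun hs w
  -- by `R (1 + S R₀) = R₀`, this `K` continues `m ∘ a ∘ (1 + S R₀)` across `z₀`
  set K : ℂ → X →L[ℂ] W := fun z => π ∘L (R₀ z - H z - H z ∘L (S ∘L R₀ z)) with hK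
  have hSR₀ : AnalyticAt ℂ (fun z => S ∘L R₀ z) z₀ := analyticAt_clm_comp analyticAt_const hR₀
  have hKan : AnalyticAt ℂ K z₀ :=
    analyticAt_clm_comp analyticAt_const ((hR₀.sub hH).sub (analyticAt_clm_comp hH hSR₀))
  have hKm : ∀ᶠ z in 𝓝[≠] z₀, ∀ x, K z x = m z (a (x + S (R₀ z x))) := by
    filter_upwards [hR, hRF] with z h1 h2 x
    have h2x := DFunLike.congr_fun h2 x
    simp only [h1, add_apply, ContinuousLinearMap.comp_apply] at h2x
    rw [← hπ (m z (a (x + S (R₀ z x))))]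
    simp only [hK, ContinuousLinearMap.comp_apply, sub_apply]
    congr 1
    simp only [map_add]
    linear_combination (norm := module) (-1 : ℂ) • h2x
  -- the derivative of the relation `(z - z₀ - N) K = a (1 + S R₀)`
  have hK' : ∀ᶠ z in 𝓝[≠] z₀, ∀ x, K z x + (z - z₀) • deriv K z x - N (deriv K z x) =
      a (S (deriv R₀ z x)) := by
    have hrel : ∀ᶠ z in 𝓝[≠] z₀, (z - z₀) • K z - N ∘L K z - (a + a ∘L (S ∘L R₀ z)) = 0 := by
      filter_upwards [hKm, self_mem_nhdsWithin] with z hz hne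
      ext1 x
      have := DFunLike.congr_fun (hm z hne) (a (x + S (R₀ z x)))
      simp only [smul_apply, add_apply,
        mul_apply_eq_comp, one_apply_eq_self] at this
      simp only [smul_apply, add_apply,
        sub_apply, ContinuousLinearMap.comp_apply, hz, this,
        zero_apply]
      rw [map_add a]
      abel
    have hev : ∀ᶠ z in 𝓝[≠] z₀, AnalyticAt ℂ K z ∧ AnalyticAt ℂ R₀ z :=
      (hKan.eventually_analyticAt.and hR₀.eventually_analyticAt).filter_mono nhdsWithin_le_nhds
    filter_upwards [eventually_eventually_nhdsWithin.2 hrel, hev, self_mem_nhdsWithin]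
      with z hz hz' hne x
    rw [isOpen_compl_singleton.nhdsWithin_eq hne] at hz
    have hd1 := hz'.1.differentiableAt.hasDerivAt
    have hd2 := hz'.2.differentiableAt.hasDerivAt
    have hd := (((hasDerivAt_id' z).sub_const z₀).fun_smul hd1).sub
      ((ContinuousLinearMap.compL ℂ X W W N).hasFDerivAt.comp_hasDerivAt z hd1) |>.sub
      (((ContinuousLinearMap.compL ℂ X X W a).hasFDerivAt.comp_hasDerivAt z
        ((ContinuousLinearMap.compL ℂ X Y X S).hasFDerivAt.comp_hasDerivAt z hd2)).const_add a)
    have h0 := hd.unique ((hasDerivAt_const z (0 : X →L[ℂ] W)).congr_of_eventuallyEq hz)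
    have h0x := DFunLike.congr_fun h0 x
    simp only [smul_apply, add_apply,
      sub_apply, ContinuousLinearMap.compL_apply,
      ContinuousLinearMap.comp_apply, zero_apply, one_smul] at h0x
    rw [← sub_eq_zero, ← h0x]
    abel
  -- by `(1 + R₀ S) R = R₀`, this `G` continues `(1 + R₀ S) ∘ j ∘ m` across `z₀`
  set G : ℂ → W →L[ℂ] Y := fun z => (R₀ z - H z - R₀ z ∘L (S ∘L H z)) ∘L σ with hG
  have hGan : AnalyticAt ℂ G z₀ :=
    analyticAt_clm_comp ((hR₀.sub hH).sub
      (analyticAt_clm_comp hR₀ (analyticAt_clm_comp analyticAt_const hH))) analyticAt_const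
  have hGm : ∀ᶠ z in 𝓝[≠] z₀, ∀ w, G z w = j (m z w) + R₀ z (S (j (m z w))) := by
    filter_upwards [hR, hFR] with z h1 h2 w
    have h2x := DFunLike.congr_fun h2 (σ w)
    simp only [h1, add_apply, ContinuousLinearMap.comp_apply, hσa, map_add] at h2x
    simp only [hG, ContinuousLinearMap.comp_apply, sub_apply]
    rw [← h2x]
    abel
  have hSι : AnalyticAt ℂ (fun _ : ℂ => S ∘L j) z₀ := analyticAt_const
  refine ⟨fun z => traceL W (deriv K z ∘L (S ∘L j)) +
    traceL W (π ∘L (G z - H z ∘L (S ∘L G z))), ?_, ?_⟩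
  · refine (analyticAt_clm_apply_const _ (analyticAt_clm_comp hKan.deriv hSι)).add
      (analyticAt_clm_apply_const _ (analyticAt_clm_comp analyticAt_const (hGan.sub
        (analyticAt_clm_comp hH (analyticAt_clm_comp analyticAt_const hGan)))))
  · filter_upwards [hR, hRF, hKm, hK', hGm, self_mem_nhdsWithin] with z h1 h2 h3 h4 h5 hne
    have e1 : m z ∘L a ∘L S ∘L deriv R₀ z ∘L S ∘L j =
        m z ∘L (K z ∘L S ∘L j) + deriv K z ∘L (S ∘L j) := by
      ext1 w
      have hmx := DFunLike.congr_fun (hm' z hne) (deriv K z (S (j w)))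
      simp only [smul_apply, add_apply,
        mul_apply_eq_comp, one_apply_eq_self] at hmx
      simp only [add_apply, ContinuousLinearMap.comp_apply,
        ← h4, map_sub, map_add, map_smul, hmx]
      abel
    -- the trace of `m K S j` is evaluated with the factor `m` moved to the right
    have e2 : (K z ∘L S ∘L j) ∘L m z =
        π ∘L (G z - H z ∘L (S ∘L G z)) - m z := by
      ext1 w
      have h2x := DFunLike.congr_fun h2 (S (j (m z w)))
      simp only [h1, add_apply, ContinuousLinearMap.comp_apply] at h2x
      have hSG : S (j (m z w)) + S (R₀ z (S (j (m z w)))) = S (G z w) := by rw [h5, map_add]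
      have h6 : j (m z (a (S (G z w)))) + H z (S (G z w)) = G z w - j (m z w) := by
        rw [← hSG, h5 w]
        simp only [map_add]
        linear_combination (norm := module) (1 : ℂ) • h2x
      simp only [ContinuousLinearMap.comp_apply, sub_apply, h3]
      rw [hSG, ← hπ (m z (a (S (G z w)))), eq_sub_of_add_eq h6]
      simp only [map_sub, hπ]
      abel
    rw [e1, map_add, traceL_comp_comm, e2, map_sub]
    ring

end Structure

/-! ### The residue theorem and the index -/

section Residue

variable {E : Type*} [NormedAddCommGroup E] [NormedSpace ℂ E] [CompleteSpace E]

/-- Higher negative powers of `z - z₀` have a primitive. -/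
theorem IsPiecewiseC1Loop.contourIntegral_inv_pow {γ : ℝ → ℂ} (hγ : IsPiecewiseC1Loop γ) {z₀ : ℂ}
    (hz₀ : ∀ t ∈ Icc (0 : ℝ) 1, γ t ≠ z₀) {k : ℕ} (hk : 1 ≤ k) :
    contourIntegral γ (fun z => ((z - z₀) ^ (k + 1))⁻¹) = 0 := by
  have hc : ContinuousOn (fun z : ℂ => ((z - z₀) ^ (k + 1))⁻¹) {z₀}ᶜ :=
    (Continuous.continuousOn (by fun_prop)).inv₀ fun z hz => pow_ne_zero _ (sub_ne_zero.2 hz)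
  refine hγ.contourIntegral_eq_zero_of_hasDerivAt hc hz₀
    (Φ := fun z => -(k : ℂ)⁻¹ * ((z - z₀) ^ k)⁻¹) fun w hw => ?_
  have h0 : w - z₀ ≠ 0 := sub_ne_zero.2 hw
  have hk0 : (k : ℂ) ≠ 0 := Nat.cast_ne_zero.2 (by omega)
  refine (((((hasDerivAt_id' w).sub_const z₀).pow k).inv (pow_ne_zero _ h0)).const_mul
    (-(k : ℂ)⁻¹)).congr_deriv ?_
  obtain ⟨n, rfl⟩ : ∃ n, k = n + 1 := ⟨k - 1, by omega⟩
  simp only [Nat.add_sub_cancel, Pi.pow_apply]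
  field_simp
  ring

theorem IsPiecewiseC1Loop.contourIntegral_principalPart {γ : ℝ → ℂ} (hγ : IsPiecewiseC1Loop γ)
    {z₀ : ℂ} (hz₀ : ∀ t ∈ Icc (0 : ℝ) 1, γ t ≠ z₀) (hwind : windingNumber γ z₀ = 1)
    {A : ℕ → E} {L : ℕ} (hA : ∀ j, L < j → A j = 0) :
    contourIntegral γ (principalPart A L z₀) = (2 * Real.pi * Complex.I : ℂ) • A 1 := by
  have hint : ∀ j ∈ Finset.Icc 1 L, ContourIntegrable γ fun z => ((z - z₀) ^ j)⁻¹ • A j :=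
    fun j _ => hγ.contourIntegrable (U := {z₀}ᶜ) (((Continuous.continuousOn (by fun_prop)).inv₀
      fun z hz => pow_ne_zero _ (sub_ne_zero.2 hz)).smul continuousOn_const) hz₀
  have hsum : contourIntegral γ (principalPart A L z₀) =
      ∑ j ∈ Finset.Icc 1 L, contourIntegral γ fun z => ((z - z₀) ^ j)⁻¹ • A j := by
    simp only [contourIntegral, principalPart, Finset.smul_sum]
    exact intervalIntegral.integral_finsetSum hint
  have h1 : contourIntegral γ (fun z => (z - z₀)⁻¹) = 2 * Real.pi * Complex.I := by
    rw [windingNumber, inv_mul_eq_one₀ Complex.two_pi_I_ne_zero] at hwind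
    exact hwind.symm
  rw [hsum, Finset.sum_eq_single 1]
  · simp only [pow_one]
    rw [contourIntegral_smul_const, h1]
  · intro j hj hj1
    rw [Finset.mem_Icc] at hj
    obtain ⟨k, rfl⟩ : ∃ k, j = k + 1 := ⟨j - 1, by omega⟩
    rw [contourIntegral_smul_const, hγ.contourIntegral_inv_pow hz₀ (by omega), zero_smul]
  · intro h
    rw [hA 1 (by simp at h; omega), contourIntegral_smul_const, smul_zero]

theorem IsPiecewiseC1Loop.contourIntegrable_of_analyticAt {E : Type*} [NormedAddCommGroup E]
    [NormedSpace ℂ E] {γ : ℝ → ℂ} (hγ : IsPiecewiseC1Loop γ) {U : Set ℂ}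
    (hγU : ∀ t ∈ Icc (0 : ℝ) 1, γ t ∈ U) {z₀ : ℂ} (hz₀ : ∀ t ∈ Icc (0 : ℝ) 1, γ t ≠ z₀)
    {f : ℂ → E} (hf : ∀ w ∈ U, w ≠ z₀ → AnalyticAt ℂ f w) : ContourIntegrable γ f :=
  hγ.contourIntegrable (U := U \ {z₀})
    (fun w hw => (hf w hw.1 hw.2).continuousAt.continuousWithinAt)
    fun t ht => ⟨hγU t ht, hz₀ t ht⟩

/-- The residue theorem for one singularity. -/
theorem IsPiecewiseC1Loop.contourIntegral_eq_residue {γ : ℝ → ℂ} (hγ : IsPiecewiseC1Loop γ)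
    {U : Set ℂ} (hU : IsOpen U) (hγU : ∀ t ∈ Icc (0 : ℝ) 1, γ t ∈ U)
    (hwind : ∀ w, w ∉ U → windingNumber γ w = 0) {z₀ : ℂ}
    (hz₀ : ∀ t ∈ Icc (0 : ℝ) 1, γ t ≠ z₀) (hwind₀ : windingNumber γ z₀ = 1) {f : ℂ → E}
    (hf : ∀ w ∈ U, w ≠ z₀ → AnalyticAt ℂ f w) {L : ℕ} {A : ℕ → E}
    (hA : HasPrincipalPart f z₀ L A) :
    contourIntegral γ f = (2 * Real.pi * Complex.I : ℂ) • A 1 := by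
  obtain ⟨hA0, H, hH, hfH⟩ := hA
  have han : ∀ w ∈ U \ {z₀}, AnalyticAt ℂ (principalPart A L z₀) w :=
    fun w hw => analyticAt_principalPart A L hw.2
  have hγ' : ∀ t ∈ Icc (0 : ℝ) 1, γ t ∈ U \ {z₀} := fun t ht => ⟨hγU t ht, hz₀ t ht⟩
  have h0 : contourIntegral γ (fun z => f z - principalPart A L z₀ z) = 0 := by
    refine hγ.contourIntegral_eq_zero_of_removable hU hγU hwind hz₀
      (fun w hw hne => (hf w hw hne).sub (han w ⟨hw, hne⟩)) hH ?_
    filter_upwards [hfH] with z hz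
    rw [hz, principalPart, add_sub_cancel_left]
  rw [contourIntegral_sub
    (hγ.contourIntegrable (fun w hw => (hf w hw.1 hw.2).continuousAt.continuousWithinAt) hγ')
    (hγ.contourIntegrable (fun w hw => (han w hw).continuousAt.continuousWithinAt) hγ'),
    sub_eq_zero, hγ.contourIntegral_principalPart hz₀ hwind₀ hA0] at h0
  exact h0

/-- The index of `1 + S R₀`, where `(1 + S R₀)⁻¹ = 1 - S R` and the principal part of `R` at `z₀`
is `j ∘ (z - z₀ - N)⁻¹ ∘ a` with `N` nilpotent on the finite-dimensional space `W`: it is the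
dimension of `W`. -/
theorem index_eq_finrank {X Y W : Type*} [NormedAddCommGroup X] [NormedSpace ℂ X] [CompleteSpace X]
    [NormedAddCommGroup Y] [NormedSpace ℂ Y] [CompleteSpace Y]
    [NormedAddCommGroup W] [NormedSpace ℂ W] [FiniteDimensional ℂ W]
    {γ : ℝ → ℂ} (hγ : IsPiecewiseC1Loop γ)
    {U : Set ℂ} (hU : IsOpen U) (hγU : ∀ t ∈ Icc (0 : ℝ) 1, γ t ∈ U)
    (hwind : ∀ w, w ∉ U → windingNumber γ w = 0) {z₀ : ℂ}
    (hz₀ : ∀ t ∈ Icc (0 : ℝ) 1, γ t ≠ z₀) (hwind₀ : windingNumber γ z₀ = 1) (hz₀U : z₀ ∈ U)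
    {S : Y →L[ℂ] X} {R R₀ H : ℂ → X →L[ℂ] Y}
    {j : W →L[ℂ] Y} {π : Y →L[ℂ] W} (hπ : ∀ w, π (j w) = w) {a : X →L[ℂ] W}
    (ha : Function.Surjective a) {N : W →L[ℂ] W} {L : ℕ} (hN : N ^ L = 0)
    (hR₀ : ∀ w ∈ U, AnalyticAt ℂ R₀ w) (hR : ∀ w ∈ U, w ≠ z₀ → AnalyticAt ℂ R w)
    (hH : AnalyticAt ℂ H z₀)
    (hRH : ∀ᶠ z in 𝓝[≠] z₀,
      R z = j ∘L principalPart (fun j => N ^ (j - 1)) L z₀ z ∘L a + H z)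
    (hRF : ∀ w ∈ U, w ≠ z₀ → R w + R w ∘L S ∘L R₀ w = R₀ w)
    (hFR : ∀ w ∈ U, w ≠ z₀ → R w + R₀ w ∘L S ∘L R w = R₀ w) :
    HasIndex γ (fun z => 1 + S ∘L R₀ z) ∧
      index γ (fun z => 1 + S ∘L R₀ z) = Module.finrank ℂ W := by
  set m : ℂ → W →L[ℂ] W := principalPart (fun j => N ^ (j - 1)) L z₀
  have hman : ∀ w ∈ U, w ≠ z₀ → AnalyticAt ℂ m w := fun w _ hne => analyticAt_principalPart _ _ hne
  have hpunct : ∀ {p : ℂ → Prop}, (∀ w ∈ U, w ≠ z₀ → p w) → ∀ᶠ z in 𝓝[≠] z₀, p z := fun hp => by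
    filter_upwards [self_mem_nhdsWithin, mem_nhdsWithin_of_mem_nhds (hU.mem_nhds hz₀U)] with z h1 h2
      using hp z h2 h1
  have hunit : ∀ w ∈ U, w ≠ z₀ → IsUnit (1 + S ∘L R₀ w) ∧
      Ring.inverse (1 + S ∘L R₀ w) = 1 - S ∘L R w := by
    intro w hw hne
    have e1 : (1 + S ∘L R₀ w) * (1 - S ∘L R w) = 1 := by
      ext1 x
      have := congrArg S (DFunLike.congr_fun (hFR w hw hne) x)
      simp only [add_apply, ContinuousLinearMap.comp_apply, map_add] at this
      simp only [mul_apply_eq_comp, add_apply, sub_apply, one_apply_eq_self,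
        ContinuousLinearMap.comp_apply, map_sub, ← this]
      abel
    have e2 : (1 - S ∘L R w) * (1 + S ∘L R₀ w) = 1 := by
      ext1 x
      have := congrArg S (DFunLike.congr_fun (hRF w hw hne) x)
      simp only [add_apply, ContinuousLinearMap.comp_apply, map_add] at this
      simp only [mul_apply_eq_comp, add_apply, sub_apply, one_apply_eq_self,
        ContinuousLinearMap.comp_apply, map_add]
      rw [eq_sub_of_add_eq this]
      abel
    exact ⟨⟨⟨_, _, e1, e2⟩, rfl⟩, Ring.inverse_unit (⟨_, _, e1, e2⟩ : (X →L[ℂ] X)ˣ)⟩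
  have hderiv : ∀ w ∈ U, HasDerivAt (fun z => 1 + S ∘L R₀ z) (S ∘L deriv R₀ w) w := fun w hw =>
    ((ContinuousLinearMap.compL ℂ X Y X S).hasFDerivAt.comp_hasDerivAt w
      (hR₀ w hw).differentiableAt.hasDerivAt).const_add 1
  have hSR₀' : ∀ w ∈ U, AnalyticAt ℂ (fun z => S ∘L deriv R₀ z) w := fun w hw =>
    analyticAt_clm_comp analyticAt_const (hR₀ w hw).deriv
  -- `R` without its principal part, which is analytic up to a removable singularity
  set R' : ℂ → X →L[ℂ] Y := fun z => R z - j ∘L m z ∘L a with hR'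
  have hR'an : ∀ w ∈ U, w ≠ z₀ → AnalyticAt ℂ R' w := fun w hw hne => (hR w hw hne).sub
    (analyticAt_clm_comp analyticAt_const (analyticAt_clm_comp (hman w hw hne) analyticAt_const))
  have hR'H : R' =ᶠ[𝓝[≠] z₀] H := by
    filter_upwards [hRH] with z hz
    exact sub_eq_of_eq_add' hz
  -- the singular part of the logarithmic derivative is `-(Φ ∘ a)`; it factors through `W`
  set Φ : ℂ → W →L[ℂ] X := fun z => (S ∘L deriv R₀ z) ∘L (S ∘L j) ∘L m z with hΦ
  have hΦan : ∀ w ∈ U, w ≠ z₀ → AnalyticAt ℂ Φ w := fun w hw hne =>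
    analyticAt_clm_comp (hSR₀' w hw) (analyticAt_clm_comp analyticAt_const (hman w hw hne))
  have hlog : ∀ w ∈ U, w ≠ z₀ → logDerivative (fun z => 1 + S ∘L R₀ z) w =
      (S ∘L deriv R₀ w) ∘L (1 - S ∘L R' w) - Φ w ∘L a := by
    intro w hw hne
    rw [logDerivative, (hderiv w hw).deriv, (hunit w hw hne).2]
    ext1 x
    simp only [hR', hΦ, mul_apply_eq_comp, sub_apply, one_apply_eq_self,
        ContinuousLinearMap.comp_apply, map_sub]
    abel
  have hfirst : ∀ w ∈ U, w ≠ z₀ →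
      AnalyticAt ℂ (fun z => (S ∘L deriv R₀ z) ∘L (1 - S ∘L R' z)) w := fun w hw hne =>
    analyticAt_clm_comp (hSR₀' w hw)
      (analyticAt_const.sub (analyticAt_clm_comp analyticAt_const (hR'an w hw hne)))
  have hsecond : ∀ w ∈ U, w ≠ z₀ → AnalyticAt ℂ (fun z => Φ z ∘L a) w := fun w hw hne =>
    analyticAt_clm_comp (hΦan w hw hne) analyticAt_const
  have hi₁ := hγ.contourIntegrable_of_analyticAt hγU hz₀ hfirst
  have hi₂ := hγ.contourIntegrable_of_analyticAt hγU hz₀ hsecond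
  have hiΦ := hγ.contourIntegrable_of_analyticAt hγU hz₀ hΦan
  have hint : contourIntegral γ (logDerivative fun z => 1 + S ∘L R₀ z) =
      -(contourIntegral γ Φ ∘L a) := by
    have h1 : contourIntegral γ (fun z => (S ∘L deriv R₀ z) ∘L (1 - S ∘L R' z)) = 0 := by
      refine hγ.contourIntegral_eq_zero_of_removable hU hγU hwind hz₀ hfirst
        (H := fun z => (S ∘L deriv R₀ z) ∘L (1 - S ∘L H z)) ?_ ?_
      · exact analyticAt_clm_comp (hSR₀' z₀ hz₀U)
          (analyticAt_const.sub (analyticAt_clm_comp analyticAt_const hH))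
      · filter_upwards [hR'H] with z hz
        rw [hz]
    have h2 : contourIntegral γ (fun z => Φ z ∘L a) = contourIntegral γ Φ ∘L a :=
      contourIntegral_clm_comp
        ((ContinuousLinearMap.compL ℂ X W X).flip a) hiΦ
    rw [contourIntegral_congr
        (g := fun z => (S ∘L deriv R₀ z) ∘L (1 - S ∘L R' z) - Φ z ∘L a)
        fun t ht => hlog _ (hγU t ht) (hz₀ t ht),
      contourIntegral_sub hi₁ hi₂, h1, h2, zero_sub]
  set ψ : W →L[ℂ] X := -((2 * Real.pi * Complex.I : ℂ)⁻¹ • contourIntegral γ Φ) with hψ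
  have hind : indexOperator γ (fun z => 1 + S ∘L R₀ z) = ψ ∘L a := by
    rw [indexOperator, hint]
    ext1 x
    simp [hψ]
  refine ⟨⟨fun t ht => ⟨(hderiv _ (hγU t ht)).differentiableAt,
    (hunit _ (hγU t ht) (hz₀ t ht)).1⟩, ?_, ?_⟩, ?_⟩
  · refine (IntervalIntegrable.sub hi₁ hi₂).congr fun t ht => ?_
    rw [uIoc_of_le zero_le_one] at ht
    have ht' := Ioc_subset_Icc_self ht
    simp only [hlog _ (hγU t ht') (hz₀ t ht'), smul_sub]
  · rw [HasFiniteRank, hind]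
    exact Submodule.finiteDimensional_of_le (S₂ := LinearMap.range ψ.toLinearMap)
      (by rintro _ ⟨x, rfl⟩; exact ⟨a x, rfl⟩)
  · rw [index, hind, finiteRankTrace_eq_trace_comp _ a.toLinearMap ψ.toLinearMap rfl]
    obtain ⟨h, hh, hth⟩ := exists_analyticAt_trace_eq hπ ha
      (fun z hz => (sub_smul_principalPart_pow hN hz).1)
      (fun z hz => (sub_smul_principalPart_pow hN hz).2) (hR₀ z₀ hz₀U) hH hRH (hpunct hRF)
      (hpunct hFR)
    have htr : contourIntegral γ (fun z => traceL W (a ∘L Φ z)) =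
        traceL W (a ∘L contourIntegral γ Φ) :=
      contourIntegral_clm_comp
        (traceL W ∘L ContinuousLinearMap.compL ℂ W X W a) hiΦ
    have hres : contourIntegral γ (fun z => traceL W (a ∘L Φ z)) =
        (2 * Real.pi * Complex.I : ℂ) • (-(Module.finrank ℂ W : ℂ)) := by
      refine hγ.contourIntegral_eq_residue hU hγU hwind hz₀ hwind₀ (L := 1)
        (A := fun j => if j = 1 then -(Module.finrank ℂ W : ℂ) else 0) (fun w hw hne =>
        analyticAt_clm_apply_const _ (analyticAt_clm_comp analyticAt_const (hΦan w hw hne)))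
        ⟨fun j hj => if_neg (by omega), h, hh, ?_⟩
      filter_upwards [hth] with z hz
      have e : traceL W (a ∘L Φ z) =
          traceL W (m z ∘L a ∘L S ∘L deriv R₀ z ∘L S ∘L j) :=
        (traceL_comp_comm (m z) (a ∘L S ∘L deriv R₀ z ∘L S ∘L j)).symm
      rw [e, hz, traceL_apply, trace_principalPart_pow hN]
      simp
      ring
    have e : LinearMap.trace ℂ W (a.toLinearMap ∘ₗ ψ.toLinearMap) = traceL W (a ∘L ψ) := rfl
    have e' : a ∘L ψ = -((2 * Real.pi * Complex.I : ℂ)⁻¹ • (a ∘L contourIntegral γ Φ)) := by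
      ext1 w
      simp [hψ]
    rw [e, e', map_neg, map_smul, ← htr, hres, smul_smul, inv_mul_cancel₀ Complex.two_pi_I_ne_zero,
      one_smul, neg_neg]

end Residue

/-! ### Resolvents -/

section Resolvents

variable {X Y : Type*} [NormedAddCommGroup X] [NormedSpace ℂ X]
  [NormedAddCommGroup Y] [NormedSpace ℂ Y]

theorem mem_graph_pushforward (j : X →L[ℂ] Y) (hj : Function.Injective j) (A : X →ₗ.[ℂ] X)
    (v : A.domain) : (j v, j (A v)) ∈ (pushforward j hj A).graph := by
  rw [LinearPMap.mem_graph_iff]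
  refine ⟨Submodule.equivMapOfInjective j.toLinearMap hj A.domain v, rfl, ?_⟩
  change j (A ((Submodule.equivMapOfInjective j.toLinearMap hj A.domain).symm _)) = _
  rw [LinearEquiv.symm_apply_apply]

/-- The resolvent identity `(P - z)⁻¹ + (P - z)⁻¹ K (Q - z)⁻¹ = (Q - z)⁻¹` for `P = K + Q`. -/
theorem IsResolventAt.add_apply {Q : X →ₗ.[ℂ] X} {K : X →ₗ[ℂ] X} {z : ℂ} {T T₀ : X →L[ℂ] X}
    (hT : IsResolventAt (K +ᵥ Q) z T) (hT₀ : IsResolventAt Q z T₀) (x : X) :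
    T x + T (K (T₀ x)) = T₀ x := by
  obtain ⟨h, hx⟩ := hT₀.1 x
  have h2 := hT.2 ⟨T₀ x, h⟩
  rw [LinearPMap.vadd_apply, add_sub_assoc, hx, add_comm, map_add] at h2
  exact h2

/-- The resolvent identity `(P - z)⁻¹ + (Q - z)⁻¹ K (P - z)⁻¹ = (Q - z)⁻¹` for `P = K + Q`. -/
theorem IsResolventAt.add_apply' {Q : X →ₗ.[ℂ] X} {K : X →ₗ[ℂ] X} {z : ℂ} {T T₀ : X →L[ℂ] X}
    (hT : IsResolventAt (K +ᵥ Q) z T) (hT₀ : IsResolventAt Q z T₀) (x : X) :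
    T x + T₀ (K (T x)) = T₀ x := by
  obtain ⟨h, hx⟩ := hT.1 x
  have h2 := hT₀.2 ⟨T x, h⟩
  have hx' : K (T x) + (Q ⟨T x, h⟩ - z • T x) = x := by
    rw [← add_sub_assoc]
    exact hx
  rw [← eq_sub_iff_add_eq'] at hx'
  rw [hx', map_sub] at h2
  change T₀ x - T₀ (K (T x)) = T x at h2
  exact sub_eq_iff_eq_add.1 h2 |>.symm

end Resolvents

end AbstractResonance

end

theorem proposition8p1
    {B₀ B B₁ : Type*}
    [NormedAddCommGroup B₀] [NormedSpace ℂ B₀] [CompleteSpace B₀]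
    [NormedAddCommGroup B] [NormedSpace ℂ B] [CompleteSpace B]
    [NormedAddCommGroup B₁] [NormedSpace ℂ B₁] [CompleteSpace B₁]
    (hB₀ : AbstractResonance.IsReflexive B₀) (hB₁ : AbstractResonance.IsReflexive B₁)
    -- the continuous dense inclusions `B₀ ⊂ B ⊂ B₁`
    (ι₀ : B₀ →L[ℂ] B) (hι₀ : Function.Injective ι₀) (hι₀d : DenseRange ι₀)
    (ι : B →L[ℂ] B₁) (hι : Function.Injective ι) (hιd : DenseRange ι)
    -- the closed operator `Q`, the perturbation `S : B → B₀` with its bounded extension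
    -- `S₁ : B₁ → B₀`, and `P = Q + S` on `Dom P = Dom Q`
    (Q : B →ₗ.[ℂ] B) (hQ : Q.IsClosed)
    (S : B →ₗ[ℂ] B₀) (S₁ : B₁ →L[ℂ] B₀) (hS : ∀ u : B, S₁ (ι u) = S u)
    (P : B →ₗ.[ℂ] B) (hP : P = (ι₀.toLinearMap ∘ₗ S) +ᵥ Q)
    -- the open sets `∅ ≠ D ⊂ D⁺`; every connected component of `D⁺` meets `D`
    (D Dplus : Set ℂ) (hD : IsOpen D) (hDne : D.Nonempty)
    (hDQ : D ⊆ AbstractResonance.resolventSet Q) (hDP : D ⊆ AbstractResonance.resolventSet P)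
    (hDplus : IsOpen Dplus) (hDD : D ⊆ Dplus)
    (hconn : ∀ w ∈ Dplus, (connectedComponentIn Dplus w ∩ D).Nonempty)
    -- the finite meromorphic extension of the resolvent of `P`
    (R : ℂ → B₀ →L[ℂ] B₁) (hR : AbstractResonance.FiniteMeromorphicOn R Dplus)
    (hRD : ∀ z ∈ D, ∀ T : B →L[ℂ] B, AbstractResonance.IsResolventAt P z T →
      R z = ι ∘L T ∘L ι₀)
    -- the analytic extension of the resolvent of `Q`
    (R₀ : ℂ → B₀ →L[ℂ] B₁) (hR₀ : AnalyticOnNhd ℂ R₀ Dplus)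
    (hR₀D : ∀ z ∈ D, ∀ T : B →L[ℂ] B, AbstractResonance.IsResolventAt Q z T →
      R₀ z = ι ∘L T ∘L ι₀)
    -- Condition I
    (hI : (AbstractResonance.pushforward ι hι P).IsClosable)
    -- Condition II
    (hII : Dense {u : B₀ | ∃ h : ι₀ u ∈ P.domain, P ⟨ι₀ u, h⟩ ∈ range ι₀})
    -- a pole `z₀` with its principal part, and a contour around it
    (z₀ : ℂ) (hz₀ : z₀ ∈ Dplus) (hpole : AbstractResonance.IsPole R z₀)
    (L : ℕ) (A : ℕ → B₀ →L[ℂ] B₁) (hA : AbstractResonance.HasPrincipalPart R z₀ L A)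
    (γ : ℝ → ℂ)
    (hγ : AbstractResonance.IsPositiveContourAround γ z₀ Dplus
      {w | w ∈ Dplus ∧ AbstractResonance.IsPole R w}) :
    -- `A 1`, the coefficient of `(z - z₀)⁻¹`, is the residue of `R` along `γ` and has finite rank
    AbstractResonance.ContourIntegrable γ R ∧
      A 1 = (2 * Real.pi * Complex.I)⁻¹ • AbstractResonance.contourIntegral γ R ∧
      AbstractResonance.HasFiniteRank (A 1) ∧
      -- the index of `I + S R₀(z)` along `γ` is well defined and equals the rank of `A 1`
      AbstractResonance.HasIndex γ (fun z => 1 + S₁ ∘L R₀ z) ∧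
      (AbstractResonance.rank (A 1) : ℂ) =
        AbstractResonance.index γ (fun z => 1 + S₁ ∘L R₀ z) := by
  subst hP
  obtain ⟨hloop, hγ, hwind₀, hwindZ, hwindD⟩ := hγ
  have hz₀' : ∀ t ∈ Icc (0 : ℝ) 1, γ t ≠ z₀ := fun t ht => (hγ t ht).2.2
  have hmer : ∀ w ∈ Dplus, MeromorphicAt R w := fun w hw => by
    obtain ⟨⟨L, A, hLA, -⟩, -⟩ := hR w hw
    exact hLA.meromorphicAt
  -- remove the poles other than `z₀` from `Dplus`
  set U : Set ℂ := {w | w ∈ Dplus ∧ (w = z₀ ∨ ¬ AbstractResonance.IsPole R w)}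
  have hU : IsOpen U := by
    rw [isOpen_iff_mem_nhds]
    rintro w ⟨hw, hw'⟩
    have h1 := AbstractResonance.eventually_ne_isPole (hmer w hw)
    rw [eventually_nhdsWithin_iff] at h1
    filter_upwards [h1, hDplus.mem_nhds hw] with z hz hzD
    refine ⟨hzD, ?_⟩
    rcases eq_or_ne z w with rfl | hne
    · exact hw'
    · exact Or.inr (hz hne)
  have hγU : ∀ t ∈ Icc (0 : ℝ) 1, γ t ∈ U := fun t ht =>
    ⟨(hγ t ht).1, Or.inr fun h => (hγ t ht).2.1 ⟨(hγ t ht).1, h⟩⟩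
  have hwind : ∀ w, w ∉ U → AbstractResonance.windingNumber γ w = 0 := by
    intro w hw
    by_cases hwD : w ∈ Dplus
    · have hw' : w ≠ z₀ ∧ AbstractResonance.IsPole R w := by
        by_contra h
        exact hw ⟨hwD, by tauto⟩
      exact hwindZ w ⟨hwD, hw'.2⟩ hw'.1
    · exact hwindD w hwD
  have hz₀U : z₀ ∈ U := ⟨hz₀, Or.inl rfl⟩
  have hRan : ∀ w ∈ U, w ≠ z₀ → AnalyticAt ℂ R w := fun w hw hne =>
    (hR w hw.1).2 (hw.2.resolve_left hne)
  have hR₀an : ∀ w ∈ U, AnalyticAt ℂ R₀ w := fun w hw => hR₀ w hw.1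
  have hSR₀ : ∀ w ∈ Dplus, AnalyticAt ℂ (fun z => S₁ ∘L R₀ z) w := fun w hw =>
    AbstractResonance.analyticAt_clm_comp analyticAt_const (hR₀ w hw)
  -- the two resolvent identities continue from `D` to `Dplus`
  have hRF0 : ∀ w ∈ Dplus, ∀ᶠ z in 𝓝[≠] w, R z + R z ∘L S₁ ∘L R₀ z - R₀ z = 0 := by
    intro w hw
    refine AbstractResonance.eventually_eq_zero_of_eq_zero_on hD hconn (fun z hz =>
      ((hmer z hz).add (AbstractResonance.meromorphicAt_clm_comp_analyticAt (hmer z hz)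
        (hSR₀ z hz))).sub (hR₀ z hz).meromorphicAt) (fun z hz => ?_) hw
    obtain ⟨T, hT⟩ := hDP hz
    obtain ⟨T₀, hT₀⟩ := hDQ hz
    ext1 x
    have h := congrArg ι (hT.add_apply hT₀ (ι₀ x))
    rw [map_add] at h
    simpa [hRD z hz T hT, hR₀D z hz T₀ hT₀, hS, sub_eq_zero] using h
  have hFR0 : ∀ w ∈ Dplus, ∀ᶠ z in 𝓝[≠] w, R z + R₀ z ∘L S₁ ∘L R z - R₀ z = 0 := by
    intro w hw
    refine AbstractResonance.eventually_eq_zero_of_eq_zero_on hD hconn (fun z hz =>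
      ((hmer z hz).add (AbstractResonance.analyticAt_clm_comp_meromorphicAt (hR₀ z hz)
        (AbstractResonance.analyticAt_clm_comp_meromorphicAt analyticAt_const (hmer z hz)))).sub
        (hR₀ z hz).meromorphicAt) (fun z hz => ?_) hw
    obtain ⟨T, hT⟩ := hDP hz
    obtain ⟨T₀, hT₀⟩ := hDQ hz
    ext1 x
    have h := congrArg ι (hT.add_apply' hT₀ (ι₀ x))
    rw [map_add] at h
    simpa [hRD z hz T hT, hR₀D z hz T₀ hT₀, hS, sub_eq_zero] using h
  have hRF : ∀ w ∈ U, w ≠ z₀ → R w + R w ∘L S₁ ∘L R₀ w = R₀ w := fun w hw hne =>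
    sub_eq_zero.1 <| AbstractResonance.eq_zero_of_eventually_eq_zero
      (((hRan w hw hne).add (AbstractResonance.analyticAt_clm_comp (hRan w hw hne)
        (hSR₀ w hw.1))).sub (hR₀an w hw)).continuousAt (hRF0 w hw.1)
  have hFR : ∀ w ∈ U, w ≠ z₀ → R w + R₀ w ∘L S₁ ∘L R w = R₀ w := fun w hw hne =>
    sub_eq_zero.1 <| AbstractResonance.eq_zero_of_eventually_eq_zero
      (((hRan w hw hne).add (AbstractResonance.analyticAt_clm_comp (hR₀an w hw)
        (AbstractResonance.analyticAt_clm_comp analyticAt_const (hRan w hw hne)))).sub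
        (hR₀an w hw)).continuousAt (hFR0 w hw.1)
  have hfin : AbstractResonance.HasFiniteRank (A 1) := by
    obtain ⟨⟨L', A', hLA, hfr⟩, -⟩ := hR z₀ hz₀
    rw [hA.coeff_unique hLA le_rfl]
    exact hfr 1
  have : FiniteDimensional ℂ (LinearMap.range (A 1).toLinearMap) := hfin
  -- `R z` is a right inverse of the closure of `P - z` on `B₁`: in the quotient by the closed graph
  -- this is the vanishing of a meromorphic function, so it passes to the Laurent coefficients
  obtain ⟨P', hP'⟩ := hI
  have hgraph : ∀ j, 1 ≤ j → ∀ u, (A j u, z₀ • A j u + A (j + 1) u) ∈ P'.graph := by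
    intro j hj u
    rw [← hP']
    set Γ := (AbstractResonance.pushforward ι hι
      ((ι₀.toLinearMap ∘ₗ S) +ᵥ Q)).graph.topologicalClosure
    have : IsClosed (Γ : Set (B₁ × B₁)) := Submodule.isClosed_topologicalClosure _
    set T₁ : (B₀ →L[ℂ] B₁) →L[ℂ] (B₁ × B₁) ⧸ Γ := Γ.mkQL ∘L ContinuousLinearMap.inl ℂ B₁ B₁ ∘L
      ContinuousLinearMap.apply ℂ B₁ u
    set T₂ : (B₀ →L[ℂ] B₁) →L[ℂ] (B₁ × B₁) ⧸ Γ := Γ.mkQL ∘L ContinuousLinearMap.inr ℂ B₁ B₁ ∘L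
      ContinuousLinearMap.apply ℂ B₁ u
    have hcomb : ∀ (V V' : B₀ →L[ℂ] B₁) (z : ℂ) (c : B₁),
        T₁ V + z • T₂ V + T₂ V' + Γ.mkQL (0, c) = Γ.mkQL (V u, z • V u + V' u + c) := by
      intro V V' z c
      have e : (V u, z • V u + V' u + c) =
          (V u, (0 : B₁)) + z • ((0 : B₁), V u) + ((0 : B₁), V' u) + ((0 : B₁), c) := by
        simp
      rw [e, map_add, map_add, map_add, map_smul]
      rfl
    have hrel : ∀ᶠ z in 𝓝[≠] z₀, T₁ (R z) + z • T₂ (R z) + Γ.mkQL (0, ι (ι₀ u)) = 0 := by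
      refine AbstractResonance.eventually_eq_zero_of_eq_zero_on hD hconn (fun z hz =>
        ((AbstractResonance.meromorphicAt_clm_apply T₁ (hmer z hz)).add
          ((MeromorphicAt.id z).smul (AbstractResonance.meromorphicAt_clm_apply T₂
            (hmer z hz)))).add (MeromorphicAt.const _ z)) (fun z hz => ?_) hz₀
      obtain ⟨T, hT⟩ := hDP hz
      obtain ⟨h, hx⟩ := hT.1 (ι₀ u)
      have hc := hcomb (R z) 0 z (ι (ι₀ u))
      rw [map_zero, add_zero, zero_apply, add_zero] at hc
      refine hc.trans ?_
      rw [Submodule.mkQL_apply, Submodule.mkQ_apply, Submodule.Quotient.mk_eq_zero]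
      refine Submodule.le_topologicalClosure _ ?_
      have hm := AbstractResonance.mem_graph_pushforward ι hι _
        (⟨T (ι₀ u), h⟩ : ((ι₀.toLinearMap ∘ₗ S) +ᵥ Q).domain)
      rw [sub_eq_iff_eq_add'.1 hx, map_add, map_smul] at hm
      rw [hRD z hz T hT]
      exact hm
    have hco := hA.coeff_relation T₁ T₂ _ hrel hj
    have hc := hcomb (A j) (A (j + 1)) z₀ 0
    rw [hco, Prod.mk_zero_zero, map_zero, add_zero, add_zero] at hc
    rw [Submodule.mkQL_apply, Submodule.mkQ_apply] at hc
    exact (Submodule.Quotient.mk_eq_zero _).1 hc.symm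
  -- as the closed graph is that of an operator `P'`, `A j u` determines `A (j + 1) u`
  have hchain : ∀ j, 1 ≤ j → ∀ u v, A j u = A 1 v → A (j + 1) u = A 2 v := by
    intro j hj u v huv
    have h1 := hgraph j hj u
    have h2 := hgraph 1 le_rfl v
    rw [huv] at h1
    exact add_left_cancel (P'.mem_graph_snd_inj h1 h2 rfl)
  -- on the dense set of Condition II, `R z (P - z) u = u`, so that `A 2 u = A 1 ((P - z₀) u)`
  have hran : ∀ u, A 2 u ∈ LinearMap.range (A 1).toLinearMap := by
    have hcl : IsClosed {u | A 2 u ∈ LinearMap.range (A 1).toLinearMap} :=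
      (Submodule.closed_of_finiteDimensional (LinearMap.range (A 1).toLinearMap)).preimage
        (A 2).continuous
    refine fun u => hcl.closure_subset_iff.2 ?_ (hII u)
    rintro u ⟨h, f, hf⟩
    have hrel : ∀ᶠ z in 𝓝[≠] z₀, ContinuousLinearMap.apply ℂ B₁ f (R z) +
        z • (-ContinuousLinearMap.apply ℂ B₁ u) (R z) + -ι (ι₀ u) = 0 := by
      refine AbstractResonance.eventually_eq_zero_of_eq_zero_on hD hconn (fun z hz =>
        ((AbstractResonance.meromorphicAt_clm_apply _ (hmer z hz)).add
          ((MeromorphicAt.id z).smul (AbstractResonance.meromorphicAt_clm_apply _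
            (hmer z hz)))).add (MeromorphicAt.const _ z)) (fun z hz => ?_) hz₀
      obtain ⟨T, hT⟩ := hDP hz
      have h2 := congrArg ι (hT.2 ⟨ι₀ u, h⟩)
      rw [← hf] at h2
      simp only [map_sub, map_smul] at h2
      simp [hRD z hz T hT, ← h2]
      abel
    have hco := hA.coeff_relation _ _ _ hrel le_rfl
    refine ⟨f - z₀ • u, ?_⟩
    simp only [ContinuousLinearMap.apply_apply, neg_apply, smul_neg] at hco
    rw [ContinuousLinearMap.coe_coe, map_sub, map_smul]
    rw [← sub_eq_zero, ← hco]
    abel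
  obtain ⟨N, hN, hpow⟩ := AbstractResonance.exists_nilpotent_of_chain hA.1 hchain hran
  obtain ⟨π, hπ⟩ := Submodule.ClosedComplemented.of_finiteDimensional
    (LinearMap.range (A 1).toLinearMap)
  obtain ⟨hA0, H, hH, hRH⟩ := id hA
  set a : B₀ →L[ℂ] LinearMap.range (A 1).toLinearMap :=
    (A 1).codRestrict _ (LinearMap.mem_range_self (A 1).toLinearMap)
  have hRH' : ∀ᶠ z in 𝓝[≠] z₀, R z = (LinearMap.range (A 1).toLinearMap).subtypeL ∘L
      AbstractResonance.principalPart (fun j => N ^ (j - 1)) L z₀ z ∘L a + H z := by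
    filter_upwards [hRH] with z hz
    rw [hz]
    congr 1
    ext1 u
    simp only [AbstractResonance.principalPart, sum_apply,
      ContinuousLinearMap.comp_apply, smul_apply, map_sum, map_smul]
    refine Finset.sum_congr rfl fun j hj => ?_
    rw [hpow j (Finset.mem_Icc.1 hj).1 u]
    rfl
  have hidx := AbstractResonance.index_eq_finrank hloop hU hγU hwind hz₀' hwind₀ hz₀U (S := S₁)
    (j := (LinearMap.range (A 1).toLinearMap).subtypeL) (π := π) hπ (a := a)
    (by rintro ⟨_, u, rfl⟩; exact ⟨u, rfl⟩) hN hR₀an hRan hH hRH' hRF hFR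
  refine ⟨hloop.contourIntegrable_of_analyticAt hγU hz₀' hRan, ?_, hfin, hidx.1, hidx.2.symm⟩
  rw [hloop.contourIntegral_eq_residue hU hγU hwind hz₀' hwind₀ hRan hA, smul_smul,
    inv_mul_cancel₀ Complex.two_pi_I_ne_zero, one_smul]
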